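/- Let $F_\chi$ be the vacuum (Fock) module over $\mathbb C$ of the Lie algebra spanned by modes $\chi_n$, $n\in\mathbb Z+\frac12$, and a central element $1$, with $[\chi_m,\chi_n]=(-1)^{m-\frac12}\delta_{m,-n}1$: it is generated by the vacuum vector $|0\rangle$ with $\chi_n|0\rangle=0$ for $n>0$, and the monomials in the $\chi_{-j}$, $j\in\frac12+\mathbb Z_{\ge0}$, applied to $|0\rangle$ form a basis. With $:\ :$ the normal ordered product (annihilation modes $\chi_n$, $n>0$, on the right), put $$h_n=\tfrac12\sum_{a,b\in\mathbb Z+\frac12,\ a+b=2n}:\chi_a\chi_b:\quad(n\in\mathbb Z),\qquad L_0=\tfrac12\sum_{k\ge 0}(-1)^k\left(k+\tfrac12\right):\chi_{-k-\frac12}\chi_{k+\frac12}: .$$ The $h_n$ are the modes of the untwisted Heisenberg field, $h_0$ is the charge operator and $2L_0$ is the degree operator. Let $F^{hwv}_\chi\subset F_\chi$ be the span of the highest weight vectors, i.e. of the $v$ with $h_nv=0$ for all $n>0$ that are eigenvectors of $h_0$. For $V=F_\chi$ or $V=F^{hwv}_\chi$ let $$\dim_{q,z}V=\mathrm{tr}_V\,q^{2L_0}z^{h_0}\in\mathbb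 Q[z,z^{-1}][[q^{1/2}]],$$ the formal series whose coefficient at $z^mq^{d/2}$ is the dimension of the space of $v\in V$ with $2L_0v=\frac d2v$ and $h_0v=mv$. Theorem. Both characters are well defined ($V$ is the direct sum of these joint eigenspaces, $d\in\mathbb Z_{\ge 0}$, $m\in\mathbb Z$, and its degree-$\frac d2$ part is finite-dimensional for every $d$). Let $$S=\sum_{k=0}^\infty\frac{z^kq^{\frac k2}}{1+z^{-1}q^{2k+\frac32}}+\sum_{k=0}^\infty\frac{z^{-k}q^{\frac{3k}2}}{1+zq^{2k+\frac12}} .$$ In $\mathbb Q[z,z^{-1}][[q^{1/2}]]$ we have $$\dim_{q,z}F^{hwv}_\chi=\frac{\prod_{l=1}^\infty(1+zq^{2l-\frac32})\prod_{l=1}^\infty(1+z^{-1}q^{2l-\frac12})}{2\prod_{i=1}^\infty(1-q^{4i})(1+q^{2i})}\cdot S,$$ $$\dim_{q,z}F_\chi=\frac{\prod_{l=1}^\infty(1+zq^{2l-\frac32})\prod_{l=1}^\infty(1+z^{-1}q^{2l-\frac12})}{2\prod_{l=1}^\infty(1-q^{4l})^2}\cdot S,$$ and also $$\dim_{q,z}F_\chi=\frac1{\prod_{j=1}^\infty(1-zq^{2j-\frac32})(1-z^{-1}q^{2j-\frac12})};$$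 comparing the two expressions for $\dim_{q,z}F_\chi$, $$S=\frac{2\prod_{l=1}^\infty(1-q^{4l})^2}{\prod_{l=1}^\infty(1-z^2q^{4l-3})\prod_{l=1}^\infty(1-z^{-2}q^{4l-1})}.$$ -/

import Mathlib

open scoped LaurentPolynomial PowerSeries PowerSeries.WithPiTopology

noncomputable section

namespace CKP

/-! ## The Fock space

Half-integer mode indices are shifted by `1/2`: for `n : ℤ` the operator `chi n` is the mode
`χ_{n + 1/2}`.  The commutation relations are `[χ_a, χ_b] = (-1)^(a - 1/2) δ_{a, -b}`. -/

/-- The vacuum module of the Lie algebra spanned by the modes `χ_a` and the central element `1`,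
realised on the polynomials in the creation modes: the variable `X k` stands for
`χ_{-k - 1/2}`, so that the monomials
`χ_{-j_r}^{m_r} ⋯ χ_{-j_1}^{m_1}|0⟩` are exactly the monomial basis. -/
abbrev Fock : Type := MvPolynomial ℕ ℂ

/-- The vacuum vector `|0⟩`. -/
def vacuum : Fock := 1

/-- The mode `χ_{n + 1/2}`. For `n = -(k + 1) < 0` it is multiplication by `X k`; for `n = k ≥ 0`
it is `(-1)^k ∂/∂X_k`. -/
def chi : ℤ → Module.End ℂ Fock
  | Int.ofNat k => (-1 : ℂ) ^ k • (MvPolynomial.pderiv k).toLinearMap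
  | Int.negSucc k => LinearMap.mulLeft ℂ (MvPolynomial.X k)

theorem chi_nonneg (k : ℕ) (v : Fock) :
    chi (k : ℤ) v = (-1 : ℂ) ^ k • MvPolynomial.pderiv k v := rfl

theorem chi_neg (k : ℕ) (v : Fock) : chi (-((k : ℤ) + 1)) v = MvPolynomial.X k * v := by
  have : -((k : ℤ) + 1) = Int.negSucc k := by omega
  rw [this]; rfl

/-- `χ_a |0⟩ = 0` for `a > 0`. -/
theorem chi_vacuum (k : ℕ) : chi (k : ℤ) vacuum = 0 := by
  rw [chi_nonneg, vacuum, Derivation.map_one_eq_zero, smul_zero]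

/-- The products of creation modes applied to the vacuum are the monomials. -/
theorem prod_chi_vacuum (l : List ℕ) :
    (l.map fun k : ℕ => chi (-((k : ℤ) + 1))).prod vacuum
      = (l.map fun k : ℕ => (MvPolynomial.X k : Fock)).prod := by
  induction l with
  | nil => simp [vacuum]
  | cons k l ih => simp [ih, chi_neg, -neg_add_rev]

/-- The commutation relations of the modes: `[χ_a, χ_b] = (-1)^(a - 1/2) δ_{a, -b}` for
`a = m + 1/2`, `b = n + 1/2`. -/
theorem chi_comm (m n : ℤ) :
    chi m * chi n - chi n * chi m = if m + n + 1 = 0 then (-1 : ℂ) ^ m • 1 else 0 := by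
  have key (k l : ℕ) (v : Fock) :
      chi k (chi (-((l : ℤ) + 1)) v) - chi (-((l : ℤ) + 1)) (chi k v)
        = if k = l then (-1 : ℂ) ^ k • v else 0 := by
    simp only [chi_nonneg, chi_neg, Derivation.leibniz, smul_eq_mul, smul_add, mul_smul_comm]
    by_cases h : k = l
    · subst h
      simp
    · simp [MvPolynomial.pderiv_X_of_ne (Ne.symm h), h]
  have hd (k l : ℕ) (v : Fock) : MvPolynomial.pderiv k (MvPolynomial.pderiv l v)
      = MvPolynomial.pderiv l (MvPolynomial.pderiv k v) := by
    have h : ⁅(MvPolynomial.pderiv k : Derivation ℂ Fock Fock),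
        (MvPolynomial.pderiv l : Derivation ℂ Fock Fock)⁆ = 0 := by
      refine MvPolynomial.derivation_ext fun i => ?_
      rw [Derivation.commutator_apply, MvPolynomial.pderiv_X, MvPolynomial.pderiv_X]
      by_cases hk : i = k <;> by_cases hl : i = l <;> simp [Pi.single_apply, hk, hl]
      all_goals split_ifs <;> simp
    have := congrArg (fun D => D v) h
    rwa [Derivation.commutator_apply, Derivation.zero_apply, sub_eq_zero] at this
  refine LinearMap.ext fun v => ?_
  rw [LinearMap.sub_apply, Module.End.mul_apply, Module.End.mul_apply]
  have cases (m : ℤ) : (∃ k : ℕ, m = k) ∨ ∃ k : ℕ, m = -((k : ℤ) + 1) := by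
    by_cases h : 0 ≤ m
    · exact Or.inl ⟨m.toNat, by omega⟩
    · exact Or.inr ⟨(-m - 1).toNat, by omega⟩
  obtain ⟨k, rfl⟩ | ⟨k, rfl⟩ := cases m <;> obtain ⟨l, rfl⟩ | ⟨l, rfl⟩ := cases n
  · rw [if_neg (by omega), LinearMap.zero_apply, chi_nonneg, chi_nonneg, chi_nonneg, chi_nonneg,
      Derivation.map_smul, Derivation.map_smul, smul_comm, hd, sub_self]
  · rw [key]
    by_cases hkl : k = l
    · rw [if_pos hkl, if_pos (by omega), zpow_natCast]; rfl
    · rw [if_neg hkl, if_neg (by omega)]; rfl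
  · rw [← neg_sub, key]
    by_cases hkl : l = k
    · subst hkl
      have h : ((-1 : ℂ) ^ (-((l : ℤ) + 1))) = - (-1) ^ l := by
        rw [zpow_neg, ← Nat.cast_succ, zpow_natCast, pow_succ]
        rcases neg_one_pow_eq_or ℂ l with h | h <;> simp [h]
      rw [if_pos rfl, if_pos (by omega), h, LinearMap.smul_apply, neg_smul]; rfl
    · rw [if_neg hkl, if_neg (by omega), neg_zero]; rfl
  · rw [if_neg (by omega), LinearMap.zero_apply, chi_neg, chi_neg, chi_neg, chi_neg,
      mul_left_comm, sub_self]

/-- The normally ordered product `:χ_{i + 1/2} χ_{j + 1/2}:` (annihilation modes on the right). -/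
def normalOrd (i j : ℤ) : Module.End ℂ Fock :=
  if 0 ≤ i then chi j * chi i else chi i * chi j

/-- A sum of operators with only finitely many nonzero terms on each vector. -/
def locFinSum {ι : Type} (A : ι → Module.End ℂ Fock)
    (hA : ∀ v, (Function.support fun i => A i v).Finite) : Module.End ℂ Fock where
  toFun v := ∑ᶠ i, A i v
  map_add' v w := by
    simp only [map_add]
    exact finsum_add_distrib (hA v) (hA w)
  map_smul' c v := by
    simp only [map_smul, RingHom.id_apply]
    exact (smul_finsum' c (hA v)).symm

theorem chi_eventually_zero (v : Fock) : ∃ N : ℕ, ∀ i : ℤ, (N : ℤ) ≤ i → chi i v = 0 := by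
  refine ⟨v.vars.sup id + 1, fun i hi => ?_⟩
  obtain ⟨k, rfl⟩ : ∃ k : ℕ, i = k := ⟨i.toNat, by omega⟩
  rw [chi_nonneg, MvPolynomial.pderiv_eq_zero_of_notMem_vars, smul_zero]
  intro hk
  have := Finset.le_sup (f := id) hk
  simp only [id] at this
  omega

theorem normalOrd_finite (s : ℤ) (v : Fock) :
    (Function.support fun i : ℤ => normalOrd i (s - i) v).Finite := by
  obtain ⟨N, hN⟩ := chi_eventually_zero v
  refine (Set.finite_Icc (min 0 (s - N)) (N : ℤ)).subset fun i hi => ?_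
  by_contra hcon
  apply hi
  simp only [normalOrd]
  split_ifs with h0
  · have : (N : ℤ) ≤ i := by
      simp only [Set.mem_Icc, not_and_or, not_le] at hcon
      omega
    simp [hN i this]
  · have : (N : ℤ) ≤ s - i := by
      simp only [Set.mem_Icc, not_and_or, not_le] at hcon
      omega
    simp [hN _ this]

/-- The modes of the untwisted Heisenberg field
`(1/4z)(:χ(z)χ(z): - :χ(-z)χ(-z):) = ∑ h_n z^(-2n-2)`, where `χ(z) = ∑ χ_a z^(-a-1/2)`:
`h_n = 1/2 ∑_{a + b = 2n} :χ_a χ_b:`. -/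
def heis (n : ℤ) : Module.End ℂ Fock :=
  (1 / 2 : ℂ) • locFinSum (fun i : ℤ => normalOrd i (2 * n - 1 - i)) (normalOrd_finite _)

theorem degree_terms_finite (v : Fock) :
    (Function.support fun k : ℕ =>
      (((-1) ^ k * (k + 1 / 2) : ℂ) • normalOrd (-((k : ℤ) + 1)) k) v).Finite := by
  obtain ⟨N, hN⟩ := chi_eventually_zero v
  refine (Set.finite_Iio N).subset fun k hk => ?_
  by_contra hcon
  apply hk
  have h0 : ¬ (0 : ℤ) ≤ -((k : ℤ) + 1) := by omega
  have h1 : (N : ℤ) ≤ k := by simpa using hcon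
  simp only [normalOrd, if_neg h0, LinearMap.smul_apply, Module.End.mul_apply, hN _ h1, map_zero,
    smul_zero]

/-- The degree operator
`L_0 = 1/2 (1/2 :χ_{-1/2} χ_{1/2}: - 3/2 :χ_{-3/2} χ_{3/2}: + 5/2 :χ_{-5/2} χ_{5/2}: - ⋯)`. -/
def L0 : Module.End ℂ Fock :=
  (1 / 2 : ℂ) • locFinSum
    (fun k : ℕ => ((-1) ^ k * (k + 1 / 2) : ℂ) • normalOrd (-((k : ℤ) + 1)) k)
    degree_terms_finite

/-- `v` is a highest weight vector for the untwisted Heisenberg algebra: `h_n v = 0` for all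
`n > 0`, and `h_0` acts on `v` by a scalar. -/
def IsHighestWeight (v : Fock) : Prop :=
  (∀ n : ℤ, 0 < n → heis n v = 0) ∧ ∃ c : ℂ, heis 0 v = c • v

/-- The space spanned by the highest weight vectors for the untwisted Heisenberg algebra. -/
def Fhwv : Submodule ℂ Fock := Submodule.span ℂ {v | IsHighestWeight v}

/-! ## Characters -/

/-- The vectors of `V` of degree `d / 2` (the eigenvalue of `2 L_0`). -/
def degreePart (V : Submodule ℂ Fock) (d : ℕ) : Submodule ℂ Fock :=
  V ⊓ Module.End.eigenspace ((2 : ℂ) • L0) ((d : ℂ) / 2)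

/-- The vectors of `V` of degree `d / 2` and charge `m` (the eigenvalue of `h_0`). -/
def weightPart (V : Submodule ℂ Fock) (d : ℕ) (m : ℤ) : Submodule ℂ Fock :=
  degreePart V d ⊓ Module.End.eigenspace (heis 0) (m : ℂ)

/-- The trace of `q^(2 L_0) z^(h_0)` on `V` makes sense as a formal series: `V` is spanned by its
joint eigenvectors with eigenvalues in `½ℕ` for `2 L_0` and in `ℤ` for `h_0`, and each degree
occurs with finite multiplicity. -/
def HasCharacter (V : Submodule ℂ Fock) : Prop :=
  (⨆ (d : ℕ) (m : ℤ), weightPart V d m) = V ∧ ∀ d : ℕ, FiniteDimensional ℂ (degreePart V d)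

/-- The ring of formal power series in `q^(1/2)`, the power series variable, whose coefficients
are Laurent polynomials in `z`. -/
abbrev CharRing : Type := ℚ[T;T⁻¹]⟦X⟧

/-- The coefficients are discrete, so that infinite sums and products in `CharRing` are taken in
the sense of formal power series. -/
instance : TopologicalSpace ℚ[T;T⁻¹] := ⊥

instance : DiscreteTopology ℚ[T;T⁻¹] := ⟨rfl⟩

/-- The monomial `z^m q^(n/2)`. -/
def zq (m : ℤ) (n : ℕ) : CharRing := PowerSeries.monomial n (LaurentPolynomial.T m)

/-- The character (graded dimension) `tr_V q^(2 L_0) z^(h_0)`: the coefficient of `z^m q^(d/2)` is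
the dimension of the space of vectors in `V` of degree `d/2` and charge `m`. -/
def character (V : Submodule ℂ Fock) : CharRing :=
  PowerSeries.mk fun d : ℕ => ∑ᶠ m : ℤ,
    (Module.finrank ℂ (weightPart V d m) : ℚ) • (LaurentPolynomial.T m : ℚ[T;T⁻¹])

/-! ## Convergence and invertibility in `CharRing` -/

theorem constantCoeff_zq (m : ℤ) {n : ℕ} (hn : 0 < n) :
    PowerSeries.constantCoeff (zq m n) = 0 := by
  rw [zq, ← PowerSeries.coeff_zero_eq_constantCoeff_apply, PowerSeries.coeff_monomial,
    if_neg (by omega)]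

theorem isUnit_one_add_zq (m : ℤ) {n : ℕ} (hn : 0 < n) : IsUnit (1 + zq m n) := by
  rw [PowerSeries.isUnit_iff_constantCoeff]
  simp [constantCoeff_zq m hn]

theorem tendsto_order {f : ℕ → CharRing} (a : ℕ → ℕ) (ha : ∀ l, l ≤ a l)
    (hf : ∀ l, ∃ g, f l = PowerSeries.monomial (a l) (1 : ℚ[T;T⁻¹]) * g) :
    Filter.Tendsto (fun l => (f l).order) Filter.atTop (nhds ⊤) := by
  refine ENat.tendsto_nhds_top_iff_natCast_lt.mpr fun n => Filter.eventually_atTop.mpr ⟨n + 1, ?_⟩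
  intro l hl
  obtain ⟨g, hg⟩ := hf l
  have h1 : ((a l : ℕ) : ℕ∞) ≤ (f l).order := by
    rw [hg]
    refine PowerSeries.nat_le_order _ _ fun i hi => ?_
    rw [← PowerSeries.X_pow_eq, PowerSeries.coeff_X_pow_mul', if_neg (by omega)]
  exact lt_of_lt_of_le (by exact_mod_cast (by have := ha l; omega)) h1

theorem zq_eq (m : ℤ) (n : ℕ) : zq m n =
    PowerSeries.monomial n (1 : ℚ[T;T⁻¹]) * PowerSeries.C (LaurentPolynomial.T m) := by
  rw [zq, mul_comm, ← PowerSeries.X_pow_eq, PowerSeries.monomial_eq_C_mul_X_pow]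

theorem multipliable_one_add (m : ℕ → ℤ) (a : ℕ → ℕ) (ha : ∀ l, l ≤ a l) :
    Multipliable fun l : ℕ => 1 + zq (m l) (a l) :=
  PowerSeries.WithPiTopology.multipliable_one_add_of_tendsto_order_atTop_nhds_top _
    (tendsto_order a ha fun _ => ⟨_, zq_eq _ _⟩)

theorem multipliable_one_sub (m : ℕ → ℤ) (a : ℕ → ℕ) (ha : ∀ l, l ≤ a l) :
    Multipliable fun l : ℕ => 1 - zq (m l) (a l) := by
  simp only [sub_eq_add_neg]
  exact PowerSeries.WithPiTopology.multipliable_one_add_of_tendsto_order_atTop_nhds_top _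
    (tendsto_order a ha fun _ => ⟨_, by rw [zq_eq, ← mul_neg]⟩)

theorem summable_zq_mul (m : ℕ → ℤ) (a : ℕ → ℕ) (ha : ∀ k, k ≤ a k) (g : ℕ → CharRing) :
    Summable fun k : ℕ => zq (m k) (a k) * g k :=
  PowerSeries.WithPiTopology.summable_of_tendsto_order_atTop_nhds_top _
    (tendsto_order a ha fun _ => ⟨_, by rw [zq_eq, mul_assoc]⟩)

theorem isUnit_tprod {f : ℕ → CharRing} (hf : Multipliable f)
    (h1 : ∀ l, PowerSeries.constantCoeff (f l) = 1) : IsUnit (∏' l, f l) := by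
  rw [PowerSeries.isUnit_iff_constantCoeff,
    hf.map_tprod _ (PowerSeries.WithPiTopology.continuous_constantCoeff _)]
  simp [h1]

/-- The sum
`∑_{k ≥ 0} z^k q^(k/2) / (1 + z⁻¹ q^(2k+3/2)) + ∑_{k ≥ 0} z^(-k) q^(3k/2) / (1 + z q^(2k+1/2))`. -/
def doubleSum : CharRing :=
  (∑' k : ℕ, zq k k * Ring.inverse (1 + zq (-1) (4 * k + 3))) +
    (∑' k : ℕ, zq (-k) (3 * k) * Ring.inverse (1 + zq 1 (4 * k + 1)))

end CKP

end

noncomputable section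

namespace CKP

/-! ## Commutators of the quadratic operators -/

/-! The Fock space side rests on one principle. Suppose `A` lowers and `B` raises degree and charge
by the same amounts `(a/2, e)`, and `[A, B]` is a nonzero scalar. Since degrees are bounded below,
`A` is onto between weight spaces, so its kernel has character `1 - z^e q^(a/2)` times the character
of the whole space. Iterating over a family in which the `A i` commute with each other, and with `B
j` for `j ≠ i`, gives the character of the common kernel as an infinite product times `character ⊤`
(`IsWeylFamily.character_iInf_ker`). For the modes `χ_a` the common kernel is the vacuum line, which
yields the product formula for the Fock space. For `h_n`, `n > 0`, it is `Fhwv`, which yields the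
factor `∏ (1 - q^(2i))`. The commutators of the quadratic operators are found by a Schur argument:
an operator commuting with all `χ_a` is a scalar, read off at the vacuum (`eq_smul_of_commute_chi`).
The identity for `S` is proved separately, inside power series. Put `P = q^4`, which is `zq 0 8`.
Geometric expansion turns `S` into the sum over `k, j ≥ 0` of `((-1)^j + (-1)^k) z^(k-j)
q^((k+3j+4kj)/2)`. Along the diagonals with `k - j` odd it cancels; along the even ones it gives
twice a partial theta series. On the product side, Euler's expansions of `1/(z^2 q; P)_∞` and
`1/(z^(-2) q^3; P)_∞` multiply to diagonal sums `∑_j P^j / ((P;P)_j (P;P)_(j+N))`. After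
multiplication by `(P;P)_∞^2` these satisfy the same recursion `f_N = 1 - P^(N+1) f_(N+1)` as the
theta series, and the recursion has only one solution because `P^(N+1)` contracts
(`qPochInf_sq_mul_diagonalSum`). The formulas containing `S` then follow by division. -/

/-- Leibniz rule for the commutator with a product. The outcome is symmetric in the two factors, so
the order imposed by normal ordering does not matter. -/
theorem normalOrd_comm_chi (i i' j : ℤ) :
    normalOrd i i' * chi j - chi j * normalOrd i i' =
      (if i' + j + 1 = 0 then (-1 : ℂ) ^ i' • chi i else 0) +
        (if i + j + 1 = 0 then (-1 : ℂ) ^ i • chi i' else 0) := by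
  have h (x y : ℤ) : chi x * chi y * chi j - chi j * (chi x * chi y) =
      (if y + j + 1 = 0 then (-1 : ℂ) ^ y • chi x else 0) +
        (if x + j + 1 = 0 then (-1 : ℂ) ^ x • chi y else 0) := by
    have : chi x * chi y * chi j - chi j * (chi x * chi y) =
        chi x * (chi y * chi j - chi j * chi y) + (chi x * chi j - chi j * chi x) * chi y := by
      rw [mul_sub, sub_mul, mul_assoc, mul_assoc, mul_assoc]; abel
    rw [this, chi_comm, chi_comm]
    congr 1 <;> split_ifs <;> simp
  by_cases h0 : 0 ≤ i
  · rw [normalOrd, if_pos h0, h, add_comm]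
  · rw [normalOrd, if_neg h0, h]

theorem locFinSum_apply {ι : Type} (A : ι → Module.End ℂ Fock)
    (hA : ∀ v, (Function.support fun i => A i v).Finite) (v : Fock) :
    locFinSum A hA v = ∑ᶠ i, A i v := rfl

/-- The commutator with a locally finite sum is computed termwise. -/
theorem locFinSum_comm {ι : Type} (A : ι → Module.End ℂ Fock)
    (hA : ∀ v, (Function.support fun i => A i v).Finite) (c : Module.End ℂ Fock) (v : Fock) :
    locFinSum A hA (c v) - c (locFinSum A hA v) = ∑ᶠ i, (A i * c - c * A i) v := by
  rw [locFinSum_apply, locFinSum_apply, map_finsum _ (hA v),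
    ← finsum_sub_distrib (hA _) ((hA v).subset fun i hi h => hi (by simp [h]))]
  rfl

theorem finsum_ite_smul {ι M : Type} [AddCommMonoid M] [DecidableEq ι] (a : ι) (f : ι → M) :
    (∑ᶠ i, if i = a then f i else 0) = f a := by
  rw [finsum_eq_single _ a fun i hi => if_neg hi, if_pos rfl]

theorem neg_one_zpow_even_add (n j : ℤ) : (-1 : ℂ) ^ (2 * n + j) = (-1) ^ j := by
  rw [zpow_add₀ (by norm_num), zpow_mul]
  norm_num

theorem neg_one_zpow_neg (j : ℤ) : (-1 : ℂ) ^ (-j) = (-1) ^ j := by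
  rw [show -j = 2 * (-j) + j by ring, neg_one_zpow_even_add]

/-- `[h_n, χ_{j + 1/2}] = (-1)^(j + 1) χ_{2n + j + 1/2}`. -/
theorem heis_comm_chi (n j : ℤ) (v : Fock) :
    heis n (chi j v) - chi j (heis n v) = (-1 : ℂ) ^ (j + 1) • chi (2 * n + j) v := by
  rw [heis, LinearMap.smul_apply, LinearMap.smul_apply, map_smul, ← smul_sub, locFinSum_comm]
  -- The mode `χ_j` is contracted at `i = 2n + j` and at `i = -j - 1`; the two contributions
  -- coincide, which absorbs the factor `1/2` of `heis`.
  have hterm (i : ℤ) : (normalOrd i (2 * n - 1 - i) * chi j - chi j * normalOrd i (2 * n - 1 - i)) v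
      = (if i = 2 * n + j then (-1 : ℂ) ^ (j + 1) • chi i v else 0) +
        (if i = -j - 1 then (-1 : ℂ) ^ (j + 1) • chi (2 * n - 1 - i) v else 0) := by
    rw [normalOrd_comm_chi, LinearMap.add_apply]
    congr 1
    · by_cases h : i = 2 * n + j
      · rw [if_pos h, if_pos (by omega), LinearMap.smul_apply,
          show 2 * n - 1 - i = -(j + 1) by omega, neg_one_zpow_neg]
      · rw [if_neg h, if_neg (by omega), LinearMap.zero_apply]
    · by_cases h : i = -j - 1
      · rw [if_pos h, if_pos (by omega), LinearMap.smul_apply,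
          show (-1 : ℂ) ^ i = (-1) ^ (j + 1) by
            rw [show i = -(j + 1) by omega, neg_one_zpow_neg]]
      · rw [if_neg h, if_neg (by omega), LinearMap.zero_apply]
  simp_rw [hterm]
  rw [finsum_add_distrib, finsum_ite_smul, finsum_ite_smul, show 2 * n - 1 - (-j - 1) = 2 * n + j by
    ring, ← two_smul ℂ, smul_smul]
  · norm_num
  · exact (Set.finite_singleton (2 * n + j)).subset fun i hi => by
      by_contra h; exact hi (if_neg h)
  · exact (Set.finite_singleton (-j - 1)).subset fun i hi => by
      by_contra h; exact hi (if_neg h)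

/-- `[2 L_0, χ_a] = -a χ_a`. -/
theorem two_L0_comm_chi (j : ℤ) (v : Fock) :
    ((2 : ℂ) • L0) (chi j v) - chi j (((2 : ℂ) • L0) v) = (-(j + 1 / 2) : ℂ) • chi j v := by
  have h2 : (2 : ℂ) • L0 = locFinSum
    (fun k : ℕ => ((-1) ^ k * (k + 1 / 2) : ℂ) • normalOrd (-((k : ℤ) + 1)) k)
    degree_terms_finite := by
    rw [L0, smul_smul]; norm_num
  rw [h2, locFinSum_comm]
  have hterm (k : ℕ) : ((((-1) ^ k * (k + 1 / 2) : ℂ) • normalOrd (-((k : ℤ) + 1)) k) * chi j -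
      chi j * (((-1) ^ k * (k + 1 / 2) : ℂ) • normalOrd (-((k : ℤ) + 1)) k)) v =
      if (k : ℤ) = j ∨ (k : ℤ) = -j - 1 then (-(j + 1 / 2) : ℂ) • chi j v else 0 := by
    have hs : ((-1 : ℂ) ^ k) * (-1) ^ k = 1 := by
      rw [← mul_pow]; norm_num
    rw [smul_mul_assoc, mul_smul_comm, LinearMap.sub_apply, LinearMap.smul_apply,
      LinearMap.smul_apply, ← smul_sub, ← LinearMap.sub_apply, normalOrd_comm_chi,
      LinearMap.add_apply]
    by_cases h1 : (k : ℤ) = j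
    · subst h1
      rw [if_neg (by omega), if_pos (by omega), if_pos (Or.inl rfl), LinearMap.zero_apply,
        zero_add, LinearMap.smul_apply, smul_smul, neg_one_zpow_neg, zpow_add₀ (by norm_num),
        zpow_natCast]
      congr 1
      push_cast
      linear_combination -(k + 1 / 2 : ℂ) * hs
    · by_cases h2 : (k : ℤ) = -j - 1
      · obtain rfl : j = -((k : ℤ) + 1) := by omega
        rw [if_pos (by omega), if_neg (by omega), if_pos (Or.inr h2), LinearMap.zero_apply,
          add_zero, LinearMap.smul_apply, smul_smul, zpow_natCast]
        congr 1
        push_cast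
        linear_combination (k + 1 / 2 : ℂ) * hs
      · rw [if_neg (by omega), if_neg (by omega), if_neg (by tauto),
          LinearMap.zero_apply, add_zero, smul_zero]
  simp_rw [hterm]
  -- According to the sign of `j`, exactly one of `j` and `-j - 1` is a natural number, so exactly
  -- one term survives.
  by_cases h0 : 0 ≤ j
  · rw [finsum_eq_single _ j.toNat fun k hk => if_neg (by omega), if_pos (by omega)]
  · rw [finsum_eq_single _ (-j - 1).toNat fun k hk => if_neg (by omega), if_pos (by omega)]

/-! ## Operators commuting with all modes -/

/-- A polynomial all of whose partial derivatives vanish is constant. -/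
theorem eq_C_of_pderiv_eq_zero {σ : Type*} (w : MvPolynomial σ ℂ)
    (h : ∀ k, MvPolynomial.pderiv k w = 0) :
    w = MvPolynomial.C (MvPolynomial.constantCoeff w) := by
  classical
  ext s
  rw [MvPolynomial.coeff_C]
  split_ifs with hs
  · rw [← hs, MvPolynomial.constantCoeff_eq]
  · obtain ⟨k, hk⟩ : ∃ k, s k ≠ 0 := by
      by_contra! hcon
      exact hs (Finsupp.ext fun k => (hcon k).symm)
    have hsk : s - Finsupp.single k 1 + Finsupp.single k 1 = s :=
      tsub_add_cancel_of_le (by simpa [Nat.one_le_iff_ne_zero] using hk)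
    have := congrArg (MvPolynomial.coeff (s - Finsupp.single k 1)) (h k)
    rw [MvPolynomial.coeff_pderiv, hsk, MvPolynomial.coeff_zero] at this
    refine (mul_eq_zero.mp this).resolve_right ?_
    exact Nat.cast_add_one_ne_zero _

/-- The modes act irreducibly: an operator commuting with all of them is a scalar. -/
theorem eq_smul_of_commute_chi (D : Module.End ℂ Fock) (hD : ∀ j v, D (chi j v) = chi j (D v))
    (v : Fock) : D v = MvPolynomial.constantCoeff (D 1) • v := by
  -- `D` commutes with the annihilation modes, so they kill `D 1` and it is constant; the creation
  -- modes then carry this constant to every monomial.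
  have h1 : D 1 = MvPolynomial.C (MvPolynomial.constantCoeff (D 1)) := by
    refine eq_C_of_pderiv_eq_zero _ fun k => ?_
    have h := hD k 1
    rw [chi_nonneg, chi_nonneg, Derivation.map_one_eq_zero, smul_zero, map_zero] at h
    exact (smul_eq_zero.mp h.symm).resolve_left (pow_ne_zero _ (by norm_num))
  induction v using MvPolynomial.induction_on with
  | C a =>
    rw [MvPolynomial.C_eq_smul_one, map_smul, smul_comm]
    congr 1
    conv_lhs => rw [h1]
    rw [MvPolynomial.C_eq_smul_one]
  | add p q hp hq => rw [map_add, hp, hq, smul_add]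
  | mul_X p k hp => rw [mul_comm, ← chi_neg, hD, hp, map_smul]

theorem constantCoeff_X_mul (k : ℕ) (v : Fock) :
    MvPolynomial.constantCoeff (MvPolynomial.X k * v) = 0 := by simp

theorem heis_one_of_nonneg {n : ℤ} (hn : 0 ≤ n) : heis n 1 = 0 := by
  rw [heis, LinearMap.smul_apply, locFinSum_apply, finsum_eq_zero_of_forall_eq_zero, smul_zero]
  intro i
  rw [normalOrd]
  have h (k : ℤ) (hk : 0 ≤ k) : chi k 1 = 0 := by
    obtain ⟨k, rfl⟩ := Int.eq_ofNat_of_zero_le hk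
    exact chi_vacuum k
  split_ifs with hi
  · rw [Module.End.mul_apply, h i hi, map_zero]
  · rw [Module.End.mul_apply, h _ (by omega), map_zero]

theorem two_L0_one : ((2 : ℂ) • L0) 1 = 0 := by
  rw [L0, LinearMap.smul_apply, LinearMap.smul_apply, locFinSum_apply,
    finsum_eq_zero_of_forall_eq_zero, smul_zero, smul_zero]
  intro k
  rw [normalOrd, if_neg (by omega), LinearMap.smul_apply, Module.End.mul_apply,
    show chi k 1 = 0 from chi_vacuum k, map_zero, smul_zero]

/-- The action of `h_{-n}` on the vacuum. -/
theorem heis_neg_one (n : ℕ) : heis (-(n : ℤ)) 1 =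
    (1 / 2 : ℂ) • ∑ i ∈ Finset.range (2 * n), MvPolynomial.X i * MvPolynomial.X (2 * n - 1 - i) := by
  rw [heis, LinearMap.smul_apply, locFinSum_apply]
  congr 1
  have hinj : Set.InjOn (fun i : ℕ => -((i : ℤ) + 1)) (Finset.range (2 * n)) := by
    intro i _ j _ h
    simp only at h
    omega
  rw [finsum_eq_sum_of_support_subset (s := (Finset.range (2 * n)).image fun i : ℕ => -((i : ℤ) + 1)),
    Finset.sum_image hinj]
  · refine Finset.sum_congr rfl fun i hi => ?_
    rw [Finset.mem_range] at hi
    rw [normalOrd, if_neg (by omega), Module.End.mul_apply,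
      show 2 * -(n : ℤ) - 1 - -((i : ℤ) + 1) = -(((2 * n - 1 - i : ℕ) : ℤ) + 1) by omega,
      chi_neg, chi_neg, mul_one]
  · intro i hi
    have h (k : ℤ) (hk : 0 ≤ k) : chi k 1 = 0 := by
      obtain ⟨k, rfl⟩ := Int.eq_ofNat_of_zero_le hk
      exact chi_vacuum k
    by_contra hcon
    apply hi
    have hi' : 0 ≤ i ∨ 0 ≤ 2 * -(n : ℤ) - 1 - i := by
      by_contra! h'
      refine hcon ?_
      simp only [Finset.coe_image, Set.mem_image, Finset.mem_coe, Finset.mem_range]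
      exact ⟨(-i - 1).toNat, by omega, by omega⟩
    simp only [normalOrd]
    split_ifs with h0
    · rw [Module.End.mul_apply, h i h0, map_zero]
    · rw [Module.End.mul_apply, h _ (hi'.resolve_left h0), map_zero]

/-- The commutator of two Heisenberg modes is a scalar. -/
theorem heis_comm_heis_scalar (m n : ℤ) (v : Fock) :
    heis m (heis n v) - heis n (heis m v) =
      MvPolynomial.constantCoeff (heis m (heis n 1) - heis n (heis m 1)) • v := by
  -- Bracketing with `h_n` shifts the index of a mode by the even number `2n`, with a sign depending
  -- only on the parity of that index. Hence the brackets with `h_m` and `h_n` commute on modes, and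
  -- `[h_m, h_n]` commutes with every `χ_j`.
  refine eq_smul_of_commute_chi (heis m * heis n - heis n * heis m) (fun j v => ?_) v
  have hs (n : ℤ) (v : Fock) (j : ℤ) :
      heis n (chi j v) = chi j (heis n v) + (-1 : ℂ) ^ (j + 1) • chi (2 * n + j) v := by
    rw [← heis_comm_chi, add_sub_cancel]
  have he (n : ℤ) : (-1 : ℂ) ^ (2 * n + j + 1) = (-1) ^ (j + 1) := by
    rw [add_assoc, neg_one_zpow_even_add]
  simp only [LinearMap.sub_apply, Module.End.mul_apply, hs, map_add, map_smul, map_sub, he,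
    smul_add]
  rw [show 2 * m + (2 * n + j) = 2 * n + (2 * m + j) by ring]
  abel

/-- Heisenberg annihilation modes commute. -/
theorem heis_comm_of_nonneg {m n : ℤ} (hm : 0 ≤ m) (hn : 0 ≤ n) (v : Fock) :
    heis m (heis n v) = heis n (heis m v) := by
  rw [← sub_eq_zero, heis_comm_heis_scalar, heis_one_of_nonneg hm, heis_one_of_nonneg hn]
  simp

/-- `[h_m, h_{-n}] = -m δ_{m,n}` for `m ≥ 0`, `n ≥ 0`. -/
theorem heis_comm_neg (m n : ℕ) (v : Fock) :
    heis m (heis (-(n : ℤ)) v) - heis (-(n : ℤ)) (heis m v) =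
      (if m = n then -(m : ℂ) else 0) • v := by
  rw [heis_comm_heis_scalar, heis_one_of_nonneg (Int.natCast_nonneg m), map_zero, sub_zero,
    heis_neg_one, map_smul, map_sum, MvPolynomial.constantCoeff_smul]
  congr 1
  have hs (v : Fock) (k : ℕ) : heis m (MvPolynomial.X k * v) =
      MvPolynomial.X k * heis m v + (-1 : ℂ) ^ k • chi (2 * m - (k + 1)) v := by
    have := heis_comm_chi m (-((k : ℤ) + 1)) v
    rw [chi_neg, chi_neg, sub_eq_iff_eq_add] at this
    rw [this, add_comm, show -((k : ℤ) + 1) + 1 = -(k : ℤ) by ring, neg_one_zpow_neg, zpow_natCast]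
    rfl
  -- Each of the `2n` quadratic terms of `h_{-n}|0⟩` contributes `-1` when `m = n`, so the total is
  -- `(1/2)(2n)(-1) = -m`.
  have hterm (i : ℕ) (hi : i ∈ Finset.range (2 * n)) : MvPolynomial.constantCoeff
      (heis m (MvPolynomial.X i * MvPolynomial.X (2 * n - 1 - i))) = if m = n then -1 else 0 := by
    rw [Finset.mem_range] at hi
    rw [hs, map_add, constantCoeff_X_mul, zero_add, MvPolynomial.constantCoeff_smul]
    by_cases h : 0 ≤ 2 * (m : ℤ) - (i + 1)
    · obtain ⟨k, hk⟩ := Int.eq_ofNat_of_zero_le h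
      rw [hk, chi_nonneg, MvPolynomial.pderiv_X, MvPolynomial.constantCoeff_smul, smul_smul]
      by_cases hmn : m = n
      · obtain rfl : 2 * n - 1 - i = k := by omega
        rw [Pi.single_eq_same, if_pos hmn, ← pow_add,
          show i + (2 * n - 1 - i) = 2 * (n - 1) + 1 by omega, pow_add, pow_mul]
        simp
      · rw [Pi.single_eq_of_ne (by omega), map_zero, smul_zero, if_neg hmn]
    · obtain ⟨k, hk⟩ : ∃ k : ℕ, 2 * (m : ℤ) - (i + 1) = -((k : ℤ) + 1) :=
        ⟨(i - 2 * m), by omega⟩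
      rw [hk, chi_neg, constantCoeff_X_mul, smul_zero, if_neg (by omega)]
  rw [map_sum, Finset.sum_congr rfl hterm, Finset.sum_const, Finset.card_range, nsmul_eq_mul]
  split_ifs with h
  · subst h
    push_cast
    simp
  · simp

/-- `L_0` kills the vacuum and its commutator with `X k` is a multiple of `X k`, so its image lies
in the ideal of the variables. This makes the vacuum scalar in `two_L0_comm_heis` vanish. -/
theorem constantCoeff_two_L0 (v : Fock) : MvPolynomial.constantCoeff (((2 : ℂ) • L0) v) = 0 := by
  induction v using MvPolynomial.induction_on with
  | C a => rw [MvPolynomial.C_eq_smul_one, map_smul, two_L0_one, smul_zero, map_zero]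
  | add p q hp hq => rw [map_add, map_add, hp, hq, add_zero]
  | mul_X p k hp =>
    have := two_L0_comm_chi (-((k : ℤ) + 1)) p
    rw [sub_eq_iff_eq_add, chi_neg, chi_neg] at this
    rw [mul_comm, this, map_add, constantCoeff_X_mul, MvPolynomial.constantCoeff_smul,
      constantCoeff_X_mul, smul_zero, add_zero]

/-- `[2 L_0, h_n] = -2n h_n`. -/
theorem two_L0_comm_heis (n : ℤ) (v : Fock) :
    ((2 : ℂ) • L0) (heis n v) - heis n (((2 : ℂ) • L0) v) = (-(2 * n) : ℂ) • heis n v := by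
  have hc := constantCoeff_two_L0
  have h1 := two_L0_one
  have hd (v : Fock) (j : ℤ) : ((2 : ℂ) • L0) (chi j v) =
      chi j (((2 : ℂ) • L0) v) + (-(j + 1 / 2) : ℂ) • chi j v := by
    rw [← two_L0_comm_chi, add_sub_cancel]
  generalize (2 : ℂ) • L0 = D at *
  have hs (n : ℤ) (v : Fock) (j : ℤ) :
      heis n (chi j v) = chi j (heis n v) + (-1 : ℂ) ^ (j + 1) • chi (2 * n + j) v := by
    rw [← heis_comm_chi, add_sub_cancel]
  -- `[2 L_0, h_n] + 2n h_n` commutes with all modes, hence is a scalar; its value on the vacuum has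
  -- no constant term, so that scalar is zero.
  have key := eq_smul_of_commute_chi (D * heis n - heis n * D + (2 * n : ℂ) • heis n) (fun j v => ?_) v
  · have h0 : MvPolynomial.constantCoeff
        ((D * heis n - heis n * D + (2 * n : ℂ) • heis n) 1) = 0 := by
      simp only [LinearMap.add_apply, LinearMap.sub_apply, Module.End.mul_apply,
        LinearMap.smul_apply, map_add, map_sub, hc, h1, map_zero,
        MvPolynomial.constantCoeff_smul]
      by_cases hn : 0 ≤ n
      · rw [heis_one_of_nonneg hn]; simp
      · obtain ⟨k, rfl⟩ : ∃ k : ℕ, n = -(k : ℤ) := ⟨(-n).toNat, by omega⟩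
        rw [heis_neg_one, MvPolynomial.constantCoeff_smul, map_sum,
          Finset.sum_eq_zero fun i _ => constantCoeff_X_mul _ _]
        simp
    rw [h0, zero_smul] at key
    simp only [LinearMap.add_apply, LinearMap.sub_apply, Module.End.mul_apply,
      LinearMap.smul_apply] at key
    rw [neg_smul, eq_neg_iff_add_eq_zero, key]
  · simp only [LinearMap.add_apply, LinearMap.sub_apply, Module.End.mul_apply,
      LinearMap.smul_apply, hs, hd, map_add, map_smul, map_sub, smul_add]
    push_cast
    module

/-! ## Monomials are joint eigenvectors -/

/-- The degree of a monomial, as a multiple of `1/2`. -/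
def degWt : (ℕ →₀ ℕ) →+ ℕ := Finsupp.weight fun k : ℕ => 2 * k + 1

/-- The charge of a monomial. -/
def chargeWt : (ℕ →₀ ℕ) →+ ℤ := Finsupp.weight fun k : ℕ => (-1 : ℤ) ^ k

/-- Multiplying by one variable adds its weight to the eigenvalue, so `D` is diagonal in the
monomial basis. For `2 L_0` and `h_0` this turns eigenspaces into conditions on exponents. -/
theorem coeff_apply_of_derivation {D : Module.End ℂ Fock} (h1 : D 1 = 0) {c : (ℕ →₀ ℕ) → ℂ}
    (c0 : c 0 = 0) (cadd : ∀ s t, c (s + t) = c s + c t)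
    (hX : ∀ (k : ℕ) v, D (MvPolynomial.X k * v) =
      MvPolynomial.X k * D v + c (Finsupp.single k 1) • (MvPolynomial.X k * v))
    (s : ℕ →₀ ℕ) (v : Fock) : MvPolynomial.coeff s (D v) = c s * MvPolynomial.coeff s v := by
  have key (t : ℕ →₀ ℕ) : ∀ v, D (MvPolynomial.monomial t 1 * v) =
      MvPolynomial.monomial t 1 * D v + c t • (MvPolynomial.monomial t 1 * v) := by
    induction t using Finsupp.induction_linear with
    | zero =>
      intro v
      rw [c0, zero_smul, add_zero, MvPolynomial.monomial_zero', MvPolynomial.C_1, one_mul, one_mul]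
    | add f g hf hg =>
      intro v
      have : (MvPolynomial.monomial (f + g) 1 : Fock) =
          MvPolynomial.monomial f 1 * MvPolynomial.monomial g 1 := by
        rw [MvPolynomial.monomial_mul, one_mul]
      rw [this, mul_assoc, hf, hg, cadd, mul_add, mul_smul_comm, add_smul, mul_assoc]
      abel
    | single k n =>
      induction n with
      | zero =>
        intro v
        rw [Finsupp.single_zero, c0, zero_smul, add_zero, MvPolynomial.monomial_zero',
          MvPolynomial.C_1, one_mul, one_mul]
      | succ n ih =>
        intro v
        have : (MvPolynomial.monomial (Finsupp.single k (n + 1)) 1 : Fock) =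
            MvPolynomial.monomial (Finsupp.single k n) 1 * MvPolynomial.X k := by
          rw [MvPolynomial.X, MvPolynomial.monomial_mul, one_mul, Finsupp.single_add]
        rw [this, mul_assoc, ih, hX, Finsupp.single_add, cadd, mul_add, mul_smul_comm, add_smul,
          mul_assoc]
        abel
  induction v using MvPolynomial.induction_on' with
  | monomial t a =>
    have := key t (MvPolynomial.C a)
    rw [MvPolynomial.C_eq_smul_one, map_smul, h1, smul_zero, mul_zero, zero_add, mul_smul_comm,
      mul_one, MvPolynomial.smul_monomial, smul_eq_mul, mul_one] at this
    rw [this, MvPolynomial.coeff_smul, smul_eq_mul, MvPolynomial.coeff_monomial]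
    split_ifs with h
    · rw [h]
    · simp
  | add p q hp hq => rw [map_add, MvPolynomial.coeff_add, hp, hq, MvPolynomial.coeff_add, mul_add]

theorem coeff_two_L0 (s : ℕ →₀ ℕ) (v : Fock) :
    MvPolynomial.coeff s (((2 : ℂ) • L0) v) = (degWt s / 2 : ℂ) * MvPolynomial.coeff s v := by
  refine coeff_apply_of_derivation (c := fun s => (degWt s / 2 : ℂ)) two_L0_one (by simp)
    (fun s t => by simp [add_div]) (fun k v => ?_) s v
  have := two_L0_comm_chi (-((k : ℤ) + 1)) v
  rw [sub_eq_iff_eq_add', chi_neg, chi_neg] at this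
  rw [this]
  congr 2
  simp only [degWt, Finsupp.weight_single, one_smul]
  push_cast
  ring

theorem coeff_heis_zero (s : ℕ →₀ ℕ) (v : Fock) :
    MvPolynomial.coeff s (heis 0 v) = (chargeWt s : ℂ) * MvPolynomial.coeff s v := by
  refine coeff_apply_of_derivation (c := fun s => (chargeWt s : ℂ)) (heis_one_of_nonneg le_rfl)
    (by simp) (fun s t => by simp) (fun k v => ?_) s v
  have := heis_comm_chi 0 (-((k : ℤ) + 1)) v
  rw [sub_eq_iff_eq_add', mul_zero, zero_add, chi_neg, chi_neg,
    show -((k : ℤ) + 1) + 1 = -(k : ℤ) by ring, neg_one_zpow_neg, zpow_natCast] at this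
  rw [this]
  congr 2
  simp [chargeWt, Finsupp.weight_single]

theorem mem_eigenspace_iff_coeff {D : Module.End ℂ Fock} {c : (ℕ →₀ ℕ) → ℂ}
    (hD : ∀ s v, MvPolynomial.coeff s (D v) = c s * MvPolynomial.coeff s v) (μ : ℂ) (v : Fock) :
    v ∈ Module.End.eigenspace D μ ↔ ∀ s, MvPolynomial.coeff s v ≠ 0 → c s = μ := by
  rw [Module.End.mem_eigenspace_iff, MvPolynomial.ext_iff]
  refine forall_congr' fun s => ?_
  rw [hD, MvPolynomial.coeff_smul, smul_eq_mul]
  constructor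
  · intro h hs
    exact mul_right_cancel₀ hs h
  · intro h
    by_cases hs : MvPolynomial.coeff s v = 0
    · rw [hs, mul_zero, mul_zero]
    · rw [h hs]

theorem mem_degree_iff (d : ℕ) (v : Fock) :
    v ∈ Module.End.eigenspace ((2 : ℂ) • L0) ((d : ℂ) / 2) ↔
      ∀ s, MvPolynomial.coeff s v ≠ 0 → degWt s = d := by
  rw [mem_eigenspace_iff_coeff coeff_two_L0]
  refine forall₂_congr fun s _ => ?_
  rw [div_left_inj' two_ne_zero, Nat.cast_inj]

theorem mem_charge_iff (m : ℤ) (v : Fock) :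
    v ∈ Module.End.eigenspace (heis 0) (m : ℂ) ↔
      ∀ s, MvPolynomial.coeff s v ≠ 0 → chargeWt s = m := by
  rw [mem_eigenspace_iff_coeff coeff_heis_zero]
  refine forall₂_congr fun s _ => ?_
  rw [Int.cast_inj]

theorem mem_weightPart_iff (V : Submodule ℂ Fock) (d : ℕ) (m : ℤ) (v : Fock) :
    v ∈ weightPart V d m ↔ v ∈ V ∧ ((2 : ℂ) • L0) v = ((d : ℂ) / 2) • v ∧
      heis 0 v = (m : ℂ) • v := by
  rw [weightPart, degreePart, Submodule.mem_inf, Submodule.mem_inf, Module.End.mem_eigenspace_iff,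
    Module.End.mem_eigenspace_iff, and_assoc]

theorem degWt_eq_sum (s : ℕ →₀ ℕ) : degWt s = s.sum fun k c => c * (2 * k + 1) := by
  simp [degWt, Finsupp.weight_apply]

/-- Every variable has positive weight, and `X k` has weight above `k`, so degree `d` bounds both
the exponents and the indices that occur. -/
theorem finite_degWt_eq (d : ℕ) : {s | degWt s = d}.Finite := by
  refine ((Finset.range (d + 1)).finsupp fun _ => Finset.range (d + 1)).finite_toSet.subset
    fun s hs => ?_
  have hk (k : ℕ) (hk : k ∈ s.support) : s k * (2 * k + 1) ≤ d := by
    rw [← show degWt s = d from hs, degWt_eq_sum]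
    exact Finset.single_le_sum (f := fun k => s k * (2 * k + 1)) (fun _ _ => Nat.zero_le _) hk
  have hk0 (k : ℕ) (h : k ∈ s.support) : k ≤ d := by
    have h1 := Nat.one_le_iff_ne_zero.mpr (Finsupp.mem_support_iff.mp h)
    nlinarith [hk k h]
  rw [Finset.mem_coe, Finset.mem_finsupp_iff]
  refine ⟨fun k h => Finset.mem_range.mpr (Nat.lt_succ_of_le (hk0 k h)), fun k _ => ?_⟩
  rw [Finset.mem_range]
  by_cases h : k ∈ s.support
  · nlinarith [hk k h]
  · rw [Finsupp.notMem_support_iff.mp h]; omega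

theorem degreePart_le_restrictSupport (V : Submodule ℂ Fock) (d : ℕ) :
    degreePart V d ≤ MvPolynomial.restrictSupport ℂ {s | degWt s = d} := by
  intro v hv
  rw [MvPolynomial.mem_restrictSupport_iff]
  intro s hs
  exact (mem_degree_iff d v).mp hv.2 s (MvPolynomial.mem_support_iff.mp hs)

theorem finiteDimensional_degreePart (V : Submodule ℂ Fock) (d : ℕ) :
    FiniteDimensional ℂ (degreePart V d) := by
  have := (finite_degWt_eq d).to_subtype
  have : FiniteDimensional ℂ (MvPolynomial.restrictSupport ℂ {s : ℕ →₀ ℕ | degWt s = d}) :=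
    Module.Basis.finiteDimensional_of_finite (MvPolynomial.basisRestrictSupport ℂ _)
  exact Submodule.finiteDimensional_of_le (degreePart_le_restrictSupport V d)

instance (V : Submodule ℂ Fock) (d : ℕ) (m : ℤ) : FiniteDimensional ℂ (weightPart V d m) :=
  have := finiteDimensional_degreePart V d
  Submodule.finiteDimensional_of_le (S₂ := degreePart V d) inf_le_left

theorem finite_support_finrank (V : Submodule ℂ Fock) (d : ℕ) :
    (Function.support fun m : ℤ => (Module.finrank ℂ (weightPart V d m) : ℚ)).Finite := by
  refine ((finite_degWt_eq d).image chargeWt).subset fun m hm => ?_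
  have hne : weightPart V d m ≠ ⊥ := by
    intro h
    apply hm
    beta_reduce
    rw [h, finrank_bot, Nat.cast_zero]
  obtain ⟨v, hv, hv0⟩ := Submodule.exists_mem_ne_zero_of_ne_bot hne
  obtain ⟨s, hs⟩ := MvPolynomial.ne_zero_iff.mp hv0
  exact ⟨s, (mem_degree_iff d v).mp hv.1.2 s hs, (mem_charge_iff m v).mp hv.2 s hs⟩

/-- A vector of negative degree vanishes. -/
theorem eq_zero_of_degree_neg {v : Fock} {d a : ℕ} (hda : d < a)
    (h : ((2 : ℂ) • L0) v = ((d : ℂ) / 2 - (a : ℂ) / 2) • v) : v = 0 := by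
  by_contra hv
  obtain ⟨s, hs⟩ := MvPolynomial.ne_zero_iff.mp hv
  have h1 := (mem_eigenspace_iff_coeff coeff_two_L0 _ v).mp (Module.End.mem_eigenspace_iff.mpr h) s hs
  have h2 : ((degWt s + a : ℕ) : ℂ) = (d : ℕ) := by
    push_cast
    linear_combination 2 * h1
  have := Nat.cast_injective h2
  omega

/-! ## Families of lowering and raising operators -/

/-- Homogeneous operators `A i` (lowering the degree by `a i / 2` and the charge by `e i`) and `B i`
(raising them by as much) which satisfy Weyl algebra relations. -/
structure IsWeylFamily (A B : ℕ → Module.End ℂ Fock) (a : ℕ → ℕ) (e : ℕ → ℤ) (c : ℕ → ℂ) :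
    Prop where
  comm_lower : ∀ i j v, A i (A j v) = A j (A i v)
  comm_raise : ∀ i j, i ≠ j → ∀ v, A i (B j v) = B j (A i v)
  weyl : ∀ i v, A i (B i v) - B i (A i v) = c i • v
  scalar_ne_zero : ∀ i, c i ≠ 0
  degree_lower : ∀ i v, ((2 : ℂ) • L0) (A i v) - A i (((2 : ℂ) • L0) v) = (-(a i / 2) : ℂ) • A i v
  degree_raise : ∀ i v, ((2 : ℂ) • L0) (B i v) - B i (((2 : ℂ) • L0) v) = (a i / 2 : ℂ) • B i v
  charge_lower : ∀ i v, heis 0 (A i v) - A i (heis 0 v) = (-(e i) : ℂ) • A i v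
  charge_raise : ∀ i v, heis 0 (B i v) - B i (heis 0 v) = (e i : ℂ) • B i v
  lt_degree : ∀ i, i < a i

/-- The vectors killed by the first `N` operators of a family. -/
def kerBelow (A : ℕ → Module.End ℂ Fock) (N : ℕ) : Submodule ℂ Fock :=
  ⨅ i ∈ Finset.range N, LinearMap.ker (A i)

theorem mem_kerBelow {A : ℕ → Module.End ℂ Fock} {N : ℕ} {v : Fock} :
    v ∈ kerBelow A N ↔ ∀ i < N, A i v = 0 := by
  simp [kerBelow]

namespace IsWeylFamily

variable {A B : ℕ → Module.End ℂ Fock} {a : ℕ → ℕ} {e : ℕ → ℤ} {c : ℕ → ℂ}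

/-- The image would have negative degree. -/
theorem lower_eq_zero (h : IsWeylFamily A B a e c) {i d : ℕ} (hd : d < a i) {v : Fock}
    (hv : ((2 : ℂ) • L0) v = ((d : ℂ) / 2) • v) : A i v = 0 := by
  refine eq_zero_of_degree_neg hd ?_
  have := h.degree_lower i v
  rw [hv, map_smul, sub_eq_iff_eq_add] at this
  rw [this, ← add_smul]
  congr 1
  ring

theorem lower_mem (h : IsWeylFamily A B a e c) {N d : ℕ} {m : ℤ} {v : Fock}
    (hv : v ∈ weightPart (kerBelow A N) (d + a N) (m + e N)) :
    A N v ∈ weightPart (kerBelow A N) d m := by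
  rw [mem_weightPart_iff, mem_kerBelow] at hv ⊢
  obtain ⟨h1, h2, h3⟩ := hv
  refine ⟨fun i hi => by rw [h.comm_lower, h1 i hi, map_zero], ?_, ?_⟩
  · have := h.degree_lower N v
    rw [h2, map_smul, sub_eq_iff_eq_add] at this
    rw [this, ← add_smul]
    congr 1
    push_cast
    ring
  · have := h.charge_lower N v
    rw [h3, map_smul, sub_eq_iff_eq_add] at this
    rw [this, ← add_smul]
    congr 1
    push_cast
    ring

theorem raise_mem (h : IsWeylFamily A B a e c) {N d : ℕ} {m : ℤ} {v : Fock}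
    (hv : v ∈ weightPart (kerBelow A N) d m) :
    B N v ∈ weightPart (kerBelow A N) (d + a N) (m + e N) := by
  rw [mem_weightPart_iff, mem_kerBelow] at hv ⊢
  obtain ⟨h1, h2, h3⟩ := hv
  refine ⟨fun i hi => by rw [h.comm_raise i N hi.ne, h1 i hi, map_zero], ?_, ?_⟩
  · have := h.degree_raise N v
    rw [h2, map_smul, sub_eq_iff_eq_add] at this
    rw [this, ← add_smul]
    congr 1
    push_cast
    ring
  · have := h.charge_raise N v
    rw [h3, map_smul, sub_eq_iff_eq_add] at this
    rw [this, ← add_smul]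
    congr 1
    push_cast
    ring

/-- The operators `B A + c j`, `j ≥ 1`, are surjective on the weight spaces. -/
theorem exists_shift_eq (h : IsWeylFamily A B a e c) (N d : ℕ) :
    ∀ (m : ℤ) (j : ℕ), ∀ w ∈ weightPart (kerBelow A N) d m,
      ∃ u ∈ weightPart (kerBelow A N) d m, B N (A N u) + (c N * (j + 1)) • u = w := by
  induction d using Nat.strong_induction_on with
  | _ d ih =>
    intro m j w hw
    have hcj : c N * (j + 1) ≠ 0 := mul_ne_zero (h.scalar_ne_zero N) (Nat.cast_add_one_ne_zero j)
    by_cases hd : d < a N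
    · refine ⟨(c N * (j + 1))⁻¹ • w, Submodule.smul_mem _ _ hw, ?_⟩
      rw [map_smul, h.lower_eq_zero hd ((mem_weightPart_iff _ _ _ _).mp hw).2.1, smul_zero,
        map_zero, zero_add, smul_smul, mul_inv_cancel₀ hcj, one_smul]
    · obtain ⟨d, rfl⟩ := Nat.exists_eq_add_of_le' (not_lt.mp hd)
      obtain ⟨m, rfl⟩ : ∃ m', m = m' + e N := ⟨m - e N, by ring⟩
      -- In lower degree, solve `(BA + c(j+2)) u = A w`. Since `(BA + c(j+1)) B = B (BA + c(j+2))`,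
      -- applying `BA + c(j+1)` to `w - B u` cancels `B A w` and leaves `c(j+1) w`.
      obtain ⟨u, hu, huw⟩ := ih d (by have := h.lt_degree N; omega) m (j + 1) _ (h.lower_mem hw)
      refine ⟨(c N * (j + 1))⁻¹ • (w - B N u),
        Submodule.smul_mem _ _ (Submodule.sub_mem _ hw (h.raise_mem hu)), ?_⟩
      have hBu : A N (B N u) = B N (A N u) + c N • u := by rw [← h.weyl, add_sub_cancel]
      have hw' : B N (A N w) = B N (B N (A N u)) + (c N * (j + 1 + 1)) • B N u := by
        rw [← huw, map_add, map_smul]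
        push_cast
        rfl
      rw [map_smul, map_smul, smul_smul, mul_inv_cancel₀ hcj, one_smul, map_sub, map_sub, hBu,
        map_add, map_smul, hw', show (B N) ((B N) ((A N) u)) + (c N * (j + 1 + 1)) • (B N) u -
          ((B N) ((B N) ((A N) u)) + c N • (B N) u) = (c N * (j + 1)) • B N u by module,
        smul_smul, inv_mul_cancel₀ hcj, one_smul, add_sub_cancel]

theorem exists_lower_eq (h : IsWeylFamily A B a e c) {N d : ℕ} {m : ℤ} {w : Fock}
    (hw : w ∈ weightPart (kerBelow A N) d m) :
    ∃ u ∈ weightPart (kerBelow A N) (d + a N) (m + e N), A N u = w := by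
  -- For `j = 0` the operator `BA + c` equals `AB`, so `B u` is a preimage of `w` under `A`.
  obtain ⟨u, hu, huw⟩ := h.exists_shift_eq N d m 0 w hw
  refine ⟨B N u, h.raise_mem hu, ?_⟩
  rw [← huw, ← sub_eq_iff_eq_add', h.weyl]
  simp

theorem weightPart_succ_of_lt (h : IsWeylFamily A B a e c) {N d : ℕ} (hd : d < a N) (m : ℤ) :
    weightPart (kerBelow A (N + 1)) d m = weightPart (kerBelow A N) d m := by
  ext v
  rw [mem_weightPart_iff, mem_weightPart_iff, mem_kerBelow, mem_kerBelow]
  refine ⟨fun hv => ⟨fun i hi => hv.1 i (by omega), hv.2⟩, fun hv => ⟨fun i hi => ?_, hv.2⟩⟩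
  rcases Nat.lt_succ_iff_lt_or_eq.mp hi with hi | rfl
  · exact hv.1 i hi
  · exact h.lower_eq_zero hd hv.2.1

/-- Rank–nullity for `A N`, which is onto by `exists_lower_eq` and whose kernel is cut out by one
more operator of the family. -/
theorem finrank_succ (h : IsWeylFamily A B a e c) (N d : ℕ) (m : ℤ) :
    Module.finrank ℂ (weightPart (kerBelow A N) d m) +
      Module.finrank ℂ (weightPart (kerBelow A (N + 1)) (d + a N) (m + e N)) =
      Module.finrank ℂ (weightPart (kerBelow A N) (d + a N) (m + e N)) := by
  let f : weightPart (kerBelow A N) (d + a N) (m + e N) →ₗ[ℂ] weightPart (kerBelow A N) d m :=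
    (A N).restrict fun v hv => h.lower_mem hv
  have hr : LinearMap.range f = ⊤ := by
    rw [LinearMap.range_eq_top]
    rintro ⟨w, hw⟩
    obtain ⟨u, hu, rfl⟩ := h.exists_lower_eq hw
    exact ⟨⟨u, hu⟩, rfl⟩
  have hk : (LinearMap.ker f).map (Submodule.subtype _) =
      weightPart (kerBelow A (N + 1)) (d + a N) (m + e N) := by
    ext v
    rw [Submodule.mem_map]
    constructor
    · rintro ⟨⟨v, hv⟩, hfv, rfl⟩
      have hAv : A N v = 0 := congrArg Subtype.val (LinearMap.mem_ker.mp hfv)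
      rw [mem_weightPart_iff, mem_kerBelow] at hv
      rw [Submodule.subtype_apply, mem_weightPart_iff, mem_kerBelow]
      refine ⟨fun i hi => ?_, hv.2⟩
      rcases Nat.lt_succ_iff_lt_or_eq.mp hi with hi | rfl
      · exact hv.1 i hi
      · exact hAv
    · intro hv
      rw [mem_weightPart_iff, mem_kerBelow] at hv
      refine ⟨⟨v, ?_⟩, ?_, rfl⟩
      · rw [mem_weightPart_iff, mem_kerBelow]
        exact ⟨fun i hi => hv.1 i (by omega), hv.2⟩
      · exact LinearMap.mem_ker.mpr (Subtype.ext (hv.1 N (by omega)))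
  have := LinearMap.finrank_range_add_finrank_ker f
  rwa [hr, finrank_top, ← Submodule.finrank_map_subtype_eq, hk] at this

end IsWeylFamily

/-! ## Characters of common kernels -/

theorem coeff_character (V : Submodule ℂ Fock) (d : ℕ) :
    PowerSeries.coeff d (character V) = ∑ᶠ m : ℤ,
      (Module.finrank ℂ (weightPart V d m) : ℚ) • (LaurentPolynomial.T m : ℚ[T;T⁻¹]) :=
  PowerSeries.coeff_mk _ _

theorem zq_eq_X_pow (m : ℤ) (n : ℕ) :
    zq m n = PowerSeries.C (LaurentPolynomial.T m) * PowerSeries.X ^ n := by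
  rw [zq, PowerSeries.monomial_eq_C_mul_X_pow]

theorem coeff_zq_mul (m : ℤ) (n d : ℕ) (f : CharRing) :
    PowerSeries.coeff d (zq m n * f) =
      if n ≤ d then LaurentPolynomial.T m * PowerSeries.coeff (d - n) f else 0 := by
  rw [zq_eq_X_pow, mul_assoc, PowerSeries.coeff_C_mul, PowerSeries.coeff_X_pow_mul', mul_ite,
    mul_zero]

theorem character_congr {V W : Submodule ℂ Fock} {d : ℕ}
    (h : ∀ m, weightPart V d m = weightPart W d m) :
    PowerSeries.coeff d (character V) = PowerSeries.coeff d (character W) := by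
  rw [coeff_character, coeff_character]
  refine finsum_congr fun m => ?_
  rw [h]

theorem finite_support_character_term (V : Submodule ℂ Fock) (d : ℕ) (g : ℤ → ℚ[T;T⁻¹]) :
    (Function.support fun m : ℤ => (Module.finrank ℂ (weightPart V d m) : ℚ) • g m).Finite :=
  (finite_support_finrank V d).subset fun m hm h0 =>
    hm (by simp only at h0 ⊢; rw [h0, zero_smul])

namespace IsWeylFamily

variable {A B : ℕ → Module.End ℂ Fock} {a : ℕ → ℕ} {e : ℕ → ℤ} {c : ℕ → ℂ}

theorem character_succ (h : IsWeylFamily A B a e c) (N : ℕ) :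
    character (kerBelow A (N + 1)) = (1 - zq (e N) (a N)) * character (kerBelow A N) := by
  ext1 d
  rw [sub_mul, one_mul, map_sub, coeff_zq_mul]
  split_ifs with hd
  · obtain ⟨d, rfl⟩ := Nat.exists_eq_add_of_le' hd
    rw [Nat.add_sub_cancel, eq_sub_iff_add_eq', coeff_character, coeff_character, coeff_character,
      ← smul_eq_mul, smul_finsum' _ (finite_support_character_term _ _ _)]
    have hshift (f : ℤ → ℚ[T;T⁻¹]) : ∑ᶠ m, f m = ∑ᶠ m, f (m + e N) :=
      (finsum_comp_equiv (Equiv.addRight (e N))).symm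
    rw [hshift fun m => (Module.finrank ℂ (weightPart (kerBelow A (N + 1)) (d + a N) m) : ℚ) •
        (LaurentPolynomial.T m : ℚ[T;T⁻¹]),
      hshift fun m => (Module.finrank ℂ (weightPart (kerBelow A N) (d + a N) m) : ℚ) •
        (LaurentPolynomial.T m : ℚ[T;T⁻¹]), ← finsum_add_distrib]
    · refine finsum_congr fun m => ?_
      rw [← h.finrank_succ, Nat.cast_add, add_smul, smul_eq_mul, mul_smul_comm,
        ← LaurentPolynomial.T_add, add_comm (e N)]
    · exact (finite_support_finrank (kerBelow A N) d).subset fun m hm h0 =>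
        hm (by simp only at h0 ⊢; rw [h0, zero_smul, smul_zero])
    · exact ((finite_support_finrank (kerBelow A (N + 1)) (d + a N)).preimage
        (add_left_injective (e N)).injOn).subset fun m hm h0 =>
        hm (by simp only at h0 ⊢; rw [h0, zero_smul])
  · rw [sub_zero]
    exact character_congr fun m => h.weightPart_succ_of_lt (not_le.mp hd) m

theorem character_kerBelow (h : IsWeylFamily A B a e c) (N : ℕ) :
    character (kerBelow A N) = (∏ i ∈ Finset.range N, (1 - zq (e i) (a i))) * character ⊤ := by
  induction N with
  | zero => simp [kerBelow]
  | succ N ih => rw [h.character_succ, ih, Finset.prod_range_succ]; ring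

/-- The character of the space of vectors killed by all lowering operators. -/
theorem character_iInf_ker (h : IsWeylFamily A B a e c) :
    character (⨅ i, LinearMap.ker (A i)) = (∏' i, (1 - zq (e i) (a i))) * character ⊤ := by
  have h1 : Filter.Tendsto (fun N => character (kerBelow A N)) Filter.atTop
      (nhds ((∏' i, (1 - zq (e i) (a i))) * character ⊤)) := by
    simp_rw [h.character_kerBelow]
    exact (multipliable_one_sub e a fun l => (h.lt_degree l).le).hasProd.tendsto_prod_nat.mul_const _
  refine tendsto_nhds_unique ?_ h1
  rw [PowerSeries.WithPiTopology.tendsto_iff_coeff_tendsto]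
  -- The coefficient in degree `d` is stable from `N = d` on: by `lt_degree` the operators of index
  -- at least `d` vanish on that degree.
  refine fun d => tendsto_atTop_of_eventually_const (i₀ := d) fun N hN => ?_
  refine character_congr fun m => ?_
  ext v
  rw [mem_weightPart_iff, mem_weightPart_iff, mem_kerBelow, Submodule.mem_iInf]
  refine ⟨fun hv => ⟨fun i => ?_, hv.2⟩, fun hv => ⟨fun i _ => hv.1 i, hv.2⟩⟩
  by_cases hi : i < N
  · exact hv.1 i hi
  · exact h.lower_eq_zero (by have := h.lt_degree i; omega) hv.2.1

end IsWeylFamily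

/-! ## Invariant subspaces are spanned by their weight vectors -/

/-- Applying `f - μ a` removes one component and rescales each other one by a nonzero factor,
because the eigenvalues are distinct. -/
theorem mem_of_sum_eigenvectors_mem {V : Type*} [AddCommGroup V] [Module ℂ V] {p : Submodule ℂ V}
    {f : Module.End ℂ V} (hf : ∀ v ∈ p, f v ∈ p) {ι : Type*} (μ : ι → ℂ)
    (hμ : Function.Injective μ) (s : Finset ι) :
    ∀ x : ι → V, (∀ i, f (x i) = μ i • x i) → ∑ i ∈ s, x i ∈ p → ∀ i ∈ s, x i ∈ p := by
  classical
  induction s using Finset.induction_on with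
  | empty => simp
  | insert a s ha ih =>
    intro x hx hsum
    rw [Finset.sum_insert ha] at hsum
    have h1 : ∑ i ∈ s, (μ i - μ a) • x i ∈ p := by
      have h2 := p.sub_mem (hf _ hsum) (p.smul_mem (μ a) hsum)
      rw [map_add, map_sum, hx, smul_add, add_sub_add_left_eq_sub, Finset.smul_sum,
        ← Finset.sum_sub_distrib] at h2
      simpa only [sub_smul, hx] using h2
    have h3 : ∀ i ∈ s, x i ∈ p := fun i hi => by
      have h4 := ih (fun i => (μ i - μ a) • x i)
        (fun i => by rw [map_smul, hx, smul_comm]) h1 i hi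
      refine (Submodule.smul_mem_iff _ (sub_ne_zero.mpr fun h => ?_)).mp h4
      exact ha (hμ h ▸ hi)
    intro i hi
    rcases Finset.mem_insert.mp hi with rfl | hi
    · exact (Submodule.add_mem_iff_left _ (p.sum_mem h3)).mp hsum
    · exact h3 i hi

/-- Grouping the monomials of `v` by degree and charge writes it as a sum of joint eigenvectors, and
invariance under both operators keeps each component in `p`. -/
theorem iSup_weightPart_eq {p : Submodule ℂ Fock} (hL : ∀ v ∈ p, ((2 : ℂ) • L0) v ∈ p)
    (hh : ∀ v ∈ p, heis 0 v ∈ p) : (⨆ (d : ℕ) (m : ℤ), weightPart p d m) = p := by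
  refine le_antisymm (iSup₂_le fun d m => inf_le_left.trans inf_le_left) fun v hv => ?_
  let y (d : ℕ) (m : ℤ) : Fock := ∑ s ∈ v.support with degWt s = d ∧ chargeWt s = m,
    MvPolynomial.monomial s (MvPolynomial.coeff s v)
  have hy (d : ℕ) (m : ℤ) (t : ℕ →₀ ℕ) (ht : MvPolynomial.coeff t (y d m) ≠ 0) :
      degWt t = d ∧ chargeWt t = m := by
    simp only [y, MvPolynomial.coeff_sum, MvPolynomial.coeff_monomial] at ht
    obtain ⟨s, hs, hst⟩ := Finset.exists_ne_zero_of_sum_ne_zero ht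
    obtain rfl : s = t := by
      by_contra hne
      exact hst (if_neg hne)
    exact (Finset.mem_filter.mp hs).2
  have hyd (d : ℕ) (m : ℤ) : ((2 : ℂ) • L0) (y d m) = ((d : ℂ) / 2) • y d m :=
    Module.End.mem_eigenspace_iff.mp ((mem_degree_iff d _).mpr fun t ht => (hy d m t ht).1)
  have hym (d : ℕ) (m : ℤ) : heis 0 (y d m) = (m : ℂ) • y d m :=
    Module.End.mem_eigenspace_iff.mp ((mem_charge_iff m _).mpr fun t ht => (hy d m t ht).2)
  have hsum : ∑ d ∈ v.support.image degWt, ∑ m ∈ v.support.image chargeWt, y d m = v := by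
    conv_rhs => rw [v.as_sum]
    rw [← Finset.sum_fiberwise_of_maps_to (g := degWt) (t := v.support.image degWt)
      fun s hs => Finset.mem_image_of_mem _ hs]
    refine Finset.sum_congr rfl fun d _ => ?_
    rw [← Finset.sum_fiberwise_of_maps_to (g := chargeWt) (t := v.support.image chargeWt)
      fun s hs => Finset.mem_image_of_mem _ (Finset.mem_filter.mp hs).1]
    refine Finset.sum_congr rfl fun m _ => ?_
    rw [Finset.filter_filter]
  have hmem : ∀ d ∈ v.support.image degWt, ∀ m ∈ v.support.image chargeWt, y d m ∈ p := by
    intro d hd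
    refine mem_of_sum_eigenvectors_mem hh (fun m : ℤ => (m : ℂ)) Int.cast_injective _ (y d)
      (hym d) ?_
    refine mem_of_sum_eigenvectors_mem hL (fun d : ℕ => (d : ℂ) / 2)
      (fun d d' h => Nat.cast_injective ((div_left_inj' two_ne_zero).mp h)) _
      (fun d => ∑ m ∈ v.support.image chargeWt, y d m) (fun d => ?_) (by rw [hsum]; exact hv) d hd
    rw [map_sum, Finset.smul_sum]
    exact Finset.sum_congr rfl fun m _ => hyd d m
  rw [← hsum]
  refine Submodule.sum_mem _ fun d hd => Submodule.sum_mem _ fun m hm => ?_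
  exact Submodule.mem_iSup_of_mem d (Submodule.mem_iSup_of_mem m
    ((mem_weightPart_iff _ _ _ _).mpr ⟨hmem d hd m hm, hyd d m, hym d m⟩))

theorem hasCharacter_of_invariant {p : Submodule ℂ Fock} (hL : ∀ v ∈ p, ((2 : ℂ) • L0) v ∈ p)
    (hh : ∀ v ∈ p, heis 0 v ∈ p) : HasCharacter p :=
  ⟨iSup_weightPart_eq hL hh, finiteDimensional_degreePart p⟩

/-! ## The character of the Fock space -/

theorem isWeylFamily_chi : IsWeylFamily (fun i => chi i) (fun i => chi (-((i : ℤ) + 1)))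
    (fun i => 2 * i + 1) (fun i => (-1) ^ i) (fun i => (-1) ^ i) where
  comm_lower i j v := by
    have := congrArg (fun D => D v) (chi_comm i j)
    rw [if_neg (by omega)] at this
    exact sub_eq_zero.mp this
  comm_raise i j hij v := by
    have := congrArg (fun D => D v) (chi_comm i (-((j : ℤ) + 1)))
    rw [if_neg (by omega)] at this
    exact sub_eq_zero.mp this
  weyl i v := by
    have := congrArg (fun D => D v) (chi_comm i (-((i : ℤ) + 1)))
    rw [if_pos (by omega), zpow_natCast] at this
    exact this
  scalar_ne_zero i := pow_ne_zero _ (by norm_num)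
  degree_lower i v := by
    rw [two_L0_comm_chi]
    congr 1
    push_cast
    ring
  degree_raise i v := by
    rw [two_L0_comm_chi]
    congr 1
    push_cast
    ring
  charge_lower i v := by
    rw [heis_comm_chi, mul_zero, zero_add, zpow_add₀ (by norm_num), zpow_natCast]
    congr 1
    push_cast
    ring
  charge_raise i v := by
    rw [heis_comm_chi, mul_zero, zero_add, show -((i : ℤ) + 1) + 1 = -(i : ℤ) by ring,
      neg_one_zpow_neg, zpow_natCast]
    congr 1
    push_cast
    ring
  lt_degree i := by omega

theorem iInf_ker_chi : (⨅ i : ℕ, LinearMap.ker (chi i)) = Submodule.span ℂ {(1 : Fock)} := by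
  ext v
  rw [Submodule.mem_iInf, Submodule.mem_span_singleton]
  constructor
  · intro hv
    refine ⟨MvPolynomial.constantCoeff v, ?_⟩
    conv_rhs => rw [eq_C_of_pderiv_eq_zero v fun k =>
      (smul_eq_zero.mp (LinearMap.mem_ker.mp (hv k))).resolve_left (pow_ne_zero k (by norm_num : (-1 : ℂ) ≠ 0))]
    rw [MvPolynomial.C_eq_smul_one]
  · rintro ⟨r, rfl⟩ i
    rw [LinearMap.mem_ker, map_smul, show chi i 1 = 0 from chi_vacuum i, smul_zero]

theorem character_span_one : character (Submodule.span ℂ {(1 : Fock)}) = 1 := by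
  have hone (s : ℕ →₀ ℕ) (hs : MvPolynomial.coeff s (1 : Fock) ≠ 0) : s = 0 := by
    by_contra h
    exact hs (by rw [MvPolynomial.coeff_one, if_neg (Ne.symm h)])
  have hpos : weightPart (Submodule.span ℂ {(1 : Fock)}) 0 0 = Submodule.span ℂ {(1 : Fock)} := by
    refine le_antisymm (inf_le_left.trans inf_le_left) fun v hv => ?_
    rw [mem_weightPart_iff]
    refine ⟨hv, ?_⟩
    obtain ⟨r, rfl⟩ := Submodule.mem_span_singleton.mp hv
    rw [map_smul, map_smul, two_L0_one, heis_one_of_nonneg le_rfl]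
    simp
  have hneg (d : ℕ) (m : ℤ) (h : ¬ (d = 0 ∧ m = 0)) :
      weightPart (Submodule.span ℂ {(1 : Fock)}) d m = ⊥ := by
    rw [eq_bot_iff]
    intro v hv
    obtain ⟨⟨hv1, hvd⟩, hvm⟩ := hv
    obtain ⟨r, rfl⟩ := Submodule.mem_span_singleton.mp hv1
    by_contra hne
    obtain ⟨s, hs⟩ := MvPolynomial.ne_zero_iff.mp hne
    have hs0 : s = 0 := hone s fun h0 => hs (by rw [MvPolynomial.coeff_smul, h0, smul_zero])
    have h1 := (mem_degree_iff d _).mp hvd s hs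
    have h2 := (mem_charge_iff m _).mp hvm s hs
    rw [hs0, map_zero] at h1 h2
    exact h ⟨h1.symm, h2.symm⟩
  ext1 d
  rw [coeff_character, PowerSeries.coeff_one]
  split_ifs with hd
  · subst hd
    rw [finsum_eq_single _ 0 fun m hm => by
      rw [hneg 0 m (by tauto), finrank_bot, Nat.cast_zero, zero_smul],
      hpos, finrank_span_singleton one_ne_zero, Nat.cast_one, one_smul, LaurentPolynomial.T_zero]
  · refine finsum_eq_zero_of_forall_eq_zero fun m => ?_
    rw [hneg d m (by tauto), finrank_bot, Nat.cast_zero, zero_smul]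

theorem tprod_mul_character_top :
    (∏' i : ℕ, (1 - zq ((-1) ^ i) (2 * i + 1))) * character ⊤ = 1 := by
  rw [← isWeylFamily_chi.character_iInf_ker, iInf_ker_chi, character_span_one]

/-! ## The character of the space of highest weight vectors -/

/-- The index is shifted so that `h_1` is number `0`. From `[2 L_0, h_n] = -2n h_n` the degree is
`4n` in units of `1/2`, and the charge is `0` because `h_0` is central among the `h_n`. -/
theorem isWeylFamily_heis : IsWeylFamily (fun i => heis (i + 1)) (fun i => heis (-((i : ℤ) + 1)))
    (fun i => 4 * (i + 1)) (fun _ => 0) (fun i => -((i : ℂ) + 1)) where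
  comm_lower i j v := heis_comm_of_nonneg (by omega) (by omega) v
  comm_raise i j hij v := by
    have := heis_comm_neg (i + 1) (j + 1) v
    rw [if_neg (by omega), zero_smul, sub_eq_zero] at this
    exact_mod_cast this
  weyl i v := by
    have := heis_comm_neg (i + 1) (i + 1) v
    rw [if_pos rfl] at this
    exact_mod_cast this
  scalar_ne_zero i := neg_ne_zero.mpr (Nat.cast_add_one_ne_zero i)
  degree_lower i v := by
    rw [two_L0_comm_heis]
    congr 1
    push_cast
    ring
  degree_raise i v := by
    rw [two_L0_comm_heis]
    congr 1
    push_cast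
    ring
  charge_lower i v := by
    rw [heis_comm_of_nonneg le_rfl (by omega), sub_self]
    simp
  charge_raise i v := by
    have := heis_comm_neg 0 (i + 1) v
    rw [if_neg (by omega), zero_smul] at this
    rw [Int.cast_zero, zero_smul]
    exact_mod_cast this
  lt_degree i := by omega

theorem mem_iInf_ker_heis (v : Fock) :
    v ∈ (⨅ i : ℕ, LinearMap.ker (heis (i + 1))) ↔ ∀ n : ℤ, 0 < n → heis n v = 0 := by
  rw [Submodule.mem_iInf]
  refine ⟨fun h n hn => ?_, fun h i => h _ (by omega)⟩
  have := h (n - 1).toNat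
  rwa [Int.toNat_of_nonneg (by omega), sub_add_cancel] at this

theorem hasCharacter_iInf_ker_heis : HasCharacter (⨅ i : ℕ, LinearMap.ker (heis (i + 1))) := by
  refine hasCharacter_of_invariant (fun v hv => ?_) fun v hv => ?_ <;>
    rw [mem_iInf_ker_heis] at hv ⊢ <;> intro n hn
  · have := two_L0_comm_heis n v
    rw [hv n hn, map_zero, smul_zero, zero_sub, neg_eq_zero] at this
    exact this
  · rw [heis_comm_of_nonneg hn.le le_rfl, hv n hn, map_zero]

/-- The common kernel of the positive modes is stable under `2 L_0` and `h_0`, hence spanned by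
joint eigenvectors, so requiring `h_0`-eigenvectors does not shrink the span. -/
theorem Fhwv_eq : Fhwv = ⨅ i : ℕ, LinearMap.ker (heis (i + 1)) := by
  refine le_antisymm (Submodule.span_le.mpr fun v hv => (mem_iInf_ker_heis v).mpr hv.1) ?_
  conv_lhs => rw [← hasCharacter_iInf_ker_heis.1]
  refine iSup₂_le fun d m v hv => Submodule.subset_span ?_
  rw [mem_weightPart_iff, mem_iInf_ker_heis] at hv
  exact ⟨hv.1, m, hv.2.2⟩

theorem character_Fhwv :
    character Fhwv = (∏' i : ℕ, (1 - zq 0 (4 * (i + 1)))) * character ⊤ := by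
  rw [Fhwv_eq, isWeylFamily_heis.character_iInf_ker]

/-! ## Summation over the quadrant -/

theorem zq_mul_zq (m m' : ℤ) (n n' : ℕ) : zq m n * zq m' n' = zq (m + m') (n + n') := by
  rw [zq, zq, zq, PowerSeries.monomial_mul_monomial, ← LaurentPolynomial.T_add]

theorem zq_zero_zero : zq 0 0 = 1 := by
  rw [zq, LaurentPolynomial.T_zero, PowerSeries.monomial_zero_eq_C_apply, map_one]

theorem zq_pow (m : ℤ) (n j : ℕ) : zq m n ^ j = zq (m * j) (n * j) := by
  induction j with
  | zero => simp [zq_zero_zero]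
  | succ j ih => rw [pow_succ, ih, zq_mul_zq]; congr 1; push_cast; ring

theorem X_pow_dvd_zq {k n : ℕ} (h : k ≤ n) (m : ℤ) :
    (PowerSeries.X : CharRing) ^ k ∣ zq m n := by
  rw [zq_eq_X_pow]
  exact (pow_dvd_pow _ h).mul_left _

theorem X_pow_dvd_zq_mul {k n : ℕ} (h : k ≤ n) (m : ℤ) (g : CharRing) :
    (PowerSeries.X : CharRing) ^ k ∣ zq m n * g :=
  (X_pow_dvd_zq h m).mul_right g

/-- Each coefficient meets only finitely many terms. This is the convergence criterion behind the
rearrangements below. -/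
theorem summable_of_X_pow_dvd {ι : Type*} {f : ι → CharRing} (w : ι → ℕ)
    (hw : ∀ d, {i | w i ≤ d}.Finite) (hf : ∀ i, PowerSeries.X ^ w i ∣ f i) : Summable f := by
  rw [PowerSeries.WithPiTopology.summable_iff_summable_coeff]
  refine fun d => summable_of_hasFiniteSupport ((hw d).subset fun i hi => ?_)
  by_contra h
  exact hi (PowerSeries.X_pow_dvd_iff.mp (hf i) d (not_le.mp h))

theorem summable_nat {f : ℕ → CharRing} (hf : ∀ k, PowerSeries.X ^ k ∣ f k) : Summable f :=
  summable_of_X_pow_dvd id Set.finite_Iic hf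

theorem summable_nat_prod {f : ℕ × ℕ → CharRing} (hf : ∀ p, PowerSeries.X ^ (p.1 + p.2) ∣ f p) :
    Summable f := by
  refine summable_of_X_pow_dvd (fun p => p.1 + p.2) (fun d => ?_) hf
  refine ((Set.finite_Iic d).prod (Set.finite_Iic d)).subset fun p hp => ?_
  rw [Set.mem_ofPred_eq] at hp
  exact ⟨Set.mem_Iic.mpr (by omega), Set.mem_Iic.mpr (by omega)⟩

theorem tsum_nat_prod {f : ℕ × ℕ → CharRing} (hf : ∀ p, PowerSeries.X ^ (p.1 + p.2) ∣ f p) :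
    ∑' p, f p = ∑' k, ∑' j, f (k, j) :=
  (summable_nat_prod hf).tsum_prod' fun k =>
    summable_nat fun j => (pow_dvd_pow _ (Nat.le_add_left j k)).trans (hf (k, j))

/-- The decomposition of the quadrant into the diagonals on and below, and above the main one. -/
def diagonalEquiv : (ℕ × ℕ) ⊕ (ℕ × ℕ) ≃ ℕ × ℕ where
  toFun := Sum.elim (fun p => (p.1 + p.2, p.2)) fun p => (p.2, p.1 + 1 + p.2)
  invFun p := if p.2 ≤ p.1 then Sum.inl (p.1 - p.2, p.2) else Sum.inr (p.2 - p.1 - 1, p.1)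
  left_inv := by
    rintro (⟨N, j⟩ | ⟨N, j⟩)
    · simp
    · have h : ¬ N + 1 + j ≤ j := by omega
      simp [h]
  right_inv := by
    rintro ⟨k, j⟩
    by_cases h : j ≤ k
    · simp [h]
    · simp only [h, if_false, Sum.elim_inr, Prod.mk.injEq, true_and]
      omega

theorem tsum_diagonal {f : ℕ × ℕ → CharRing} (hf : ∀ p, PowerSeries.X ^ (p.1 + p.2) ∣ f p) :
    ∑' p, f p = (∑' N, ∑' j, f (N + j, j)) + ∑' N, ∑' j, f (j, N + 1 + j) := by
  have h1 (p : ℕ × ℕ) : PowerSeries.X ^ (p.1 + p.2) ∣ f (p.1 + p.2, p.2) :=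
    (pow_dvd_pow _ (by simp only; omega)).trans (hf _)
  have h2 (p : ℕ × ℕ) : PowerSeries.X ^ (p.1 + p.2) ∣ f (p.2, p.1 + 1 + p.2) :=
    (pow_dvd_pow _ (by simp only; omega)).trans (hf _)
  rw [← diagonalEquiv.tsum_eq, Summable.tsum_sum (f := fun x => f (diagonalEquiv x))
    (summable_nat_prod h1) (summable_nat_prod h2)]
  exact congrArg₂ (· + ·) (tsum_nat_prod h1) (tsum_nat_prod h2)

theorem eq_of_X_pow_dvd_sub {f g : CharRing} (h : ∀ k, PowerSeries.X ^ k ∣ f - g) : f = g := by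
  ext1 d
  have := PowerSeries.X_pow_dvd_iff.mp (h (d + 1)) d (Nat.lt_succ_self d)
  rwa [map_sub, sub_eq_zero] at this

/-! ## Euler's expansion -/

/-- The finite `q`-Pochhammer symbol `∏_{i = 1}^{k} (1 - q^(4i))`. -/
def qPoch (k : ℕ) : CharRing := ∏ i ∈ Finset.range k, (1 - zq 0 (8 * (i + 1)))

/-- The reciprocal of `qPoch`. -/
def qPochInv (k : ℕ) : CharRing := Ring.inverse (qPoch k)

theorem isUnit_one_sub_zq (m : ℤ) {n : ℕ} (hn : 0 < n) : IsUnit (1 - zq m n) := by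
  rw [PowerSeries.isUnit_iff_constantCoeff]
  simp [constantCoeff_zq m hn]

theorem isUnit_qPoch (k : ℕ) : IsUnit (qPoch k) := by
  induction k with
  | zero => simp [qPoch]
  | succ k ih =>
    rw [qPoch, Finset.prod_range_succ]
    exact ih.mul (isUnit_one_sub_zq 0 (by omega))

theorem qPochInv_zero : qPochInv 0 = 1 := by simp [qPochInv, qPoch]

theorem one_sub_mul_qPochInv_succ (k : ℕ) :
    (1 - zq 0 (8 * (k + 1))) * qPochInv (k + 1) = qPochInv k := by
  have h1 : qPoch (k + 1) * qPochInv (k + 1) = 1 := Ring.mul_inverse_cancel _ (isUnit_qPoch _)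
  have h2 : qPoch k * qPochInv k = 1 := Ring.mul_inverse_cancel _ (isUnit_qPoch _)
  refine (isUnit_qPoch k).mul_left_cancel ?_
  have h3 : qPoch (k + 1) = qPoch k * (1 - zq 0 (8 * (k + 1))) := Finset.prod_range_succ _ _
  rw [h2, ← mul_assoc, ← h3, h1]

theorem X_pow_dvd_euler_term (m : ℤ) {n : ℕ} (hn : 0 < n) (k : ℕ) :
    (PowerSeries.X : CharRing) ^ k ∣ zq (m * k) (n * k) * qPochInv k :=
  X_pow_dvd_zq_mul (Nat.le_mul_of_pos_left k hn) _ _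

/-- Euler's series `∑ x^k / (P; P)_k` for `x = z^m q^(n/2)`, `P = q^4`. -/
def eulerSum (m : ℤ) (n : ℕ) : CharRing := ∑' k : ℕ, zq (m * k) (n * k) * qPochInv k

/-- The functional equation `(1 - x) E(x) = E(xP)`, with `n + 8` encoding `xP`. The coefficients of
`x^(k+1)` agree because `1/(P;P)_k = (1 - P^(k+1))/(P;P)_(k+1)`. -/
theorem one_sub_mul_eulerSum (m : ℤ) {n : ℕ} (hn : 0 < n) :
    (1 - zq m n) * eulerSum m n = eulerSum m (n + 8) := by
  have h1 := summable_nat (X_pow_dvd_euler_term m hn)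
  have h2 := summable_nat (X_pow_dvd_euler_term m (show 0 < n + 8 by omega))
  have h3 : Summable fun k : ℕ => zq (m * (k + 1 : ℕ)) (n * (k + 1)) * qPochInv (k + 1) :=
    (summable_nat_add_iff 1).mpr h1
  have h4 : Summable fun k : ℕ => zq (m * (k + 1 : ℕ)) ((n + 8) * (k + 1)) * qPochInv (k + 1) :=
    (summable_nat_add_iff 1).mpr h2
  rw [sub_mul, one_mul, sub_eq_iff_eq_add]
  conv_lhs => rw [eulerSum, h1.tsum_eq_zero_add]
  rw [eulerSum, h2.tsum_eq_zero_add, eulerSum, ← h1.tsum_mul_left, add_assoc,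
    ← h4.tsum_add (h1.mul_left _)]
  refine congrArg₂ (· + ·) (by simp) (tsum_congr fun k => ?_)
  rw [← one_sub_mul_qPochInv_succ k, ← mul_assoc (zq m n), zq_mul_zq, sub_mul, one_mul, mul_sub,
    ← mul_assoc (zq _ _) (zq 0 _), zq_mul_zq,
    show m + m * (k : ℤ) + 0 = m * (k + 1 : ℕ) by push_cast; ring,
    show m + m * (k : ℤ) = m * (k + 1 : ℕ) by push_cast; ring,
    show n + n * k = n * (k + 1) by ring, show n * (k + 1) + 8 * (k + 1) = (n + 8) * (k + 1) by ring]
  ring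

theorem prod_mul_eulerSum (m : ℤ) {n : ℕ} (hn : 0 < n) (L : ℕ) :
    (∏ l ∈ Finset.range L, (1 - zq m (n + 8 * l))) * eulerSum m n = eulerSum m (n + 8 * L) := by
  induction L with
  | zero => simp
  | succ L ih =>
    rw [Finset.prod_range_succ, mul_right_comm, ih, mul_comm, one_sub_mul_eulerSum m (by omega)]
    congr 1

theorem X_pow_dvd_eulerSum_sub_one (m : ℤ) {n : ℕ} (hn : 0 < n) :
    PowerSeries.X ^ n ∣ eulerSum m n - 1 := by
  have h1 := summable_nat (X_pow_dvd_euler_term m hn)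
  have h3 : Summable fun k : ℕ => zq (m * k) (n * k) * qPochInv (k + 1) :=
    summable_nat fun k => X_pow_dvd_zq_mul (Nat.le_mul_of_pos_left k hn) _ _
  rw [eulerSum, h1.tsum_eq_zero_add, Nat.cast_zero, mul_zero, mul_zero, zq_zero_zero,
    qPochInv_zero, one_mul, add_sub_cancel_left]
  have : (∑' k : ℕ, zq (m * (k + 1 : ℕ)) (n * (k + 1)) * qPochInv (k + 1)) =
      zq m n * ∑' k : ℕ, zq (m * k) (n * k) * qPochInv (k + 1) := by
    rw [← h3.tsum_mul_left]
    refine tsum_congr fun k => ?_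
    rw [← mul_assoc, zq_mul_zq]
    congr 2
    · push_cast; ring
    · ring
  rw [this]
  exact X_pow_dvd_zq_mul le_rfl _ _

/-- Euler's identity `∑ x^k / (P; P)_k = 1 / (x; P)_∞`. -/
theorem tprod_mul_eulerSum (m : ℤ) {n : ℕ} (hn : 0 < n) :
    (∏' l : ℕ, (1 - zq m (n + 8 * l))) * eulerSum m n = 1 := by
  have hm : Multipliable fun l : ℕ => 1 - zq m (n + 8 * l) :=
    multipliable_one_sub (fun _ => m) (fun l => n + 8 * l) fun l => by omega
  refine tendsto_nhds_unique (hm.hasProd.tendsto_prod_nat.mul_const _) ?_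
  simp_rw [prod_mul_eulerSum m hn]
  rw [PowerSeries.WithPiTopology.tendsto_iff_coeff_tendsto]
  refine fun d => tendsto_atTop_of_eventually_const (i₀ := d) fun L hL => ?_
  have := PowerSeries.X_pow_dvd_iff.mp
    (X_pow_dvd_eulerSum_sub_one m (show 0 < n + 8 * L by omega)) d (by omega)
  rwa [map_sub, sub_eq_zero] at this

/-- At `x = P` the partial sums of Euler's series telescope, so `1/(P;P)_M` converges to `eulerSum 0
8`. -/
theorem sum_range_euler (M : ℕ) :
    ∑ k ∈ Finset.range (M + 1), zq (0 * k) (8 * k) * qPochInv k = qPochInv M := by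
  induction M with
  | zero => simp [qPochInv_zero, zq_zero_zero]
  | succ M ih =>
    rw [Finset.sum_range_succ, ih, ← one_sub_mul_qPochInv_succ M, zero_mul]
    ring

theorem tendsto_qPochInv : Filter.Tendsto qPochInv Filter.atTop (nhds (eulerSum 0 8)) := by
  have h := (summable_nat (X_pow_dvd_euler_term 0 (show 0 < 8 by omega))).hasSum.tendsto_sum_nat
  refine ((Filter.tendsto_add_atTop_iff_nat 1).mpr h).congr fun M => ?_
  exact sum_range_euler M

/-! ## The diagonal coefficients -/

/-- `∑_j P^j / ((P; P)_j (P; P)_{j + N})`. -/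
def diagonalSum (N : ℕ) : CharRing := ∑' j : ℕ, zq 0 (8 * j) * (qPochInv j * qPochInv (j + N))

/-- The partial theta series `∑_j (-1)^j P^(j(j + 1 + N)/2)`. -/
def partialTheta (N : ℕ) : CharRing :=
  ∑' j : ℕ, (-1) ^ j * zq 0 (4 * j * (j + 1) + 4 * N * j)

theorem X_pow_dvd_diagonalSum_term (N j : ℕ) :
    (PowerSeries.X : CharRing) ^ j ∣ zq 0 (8 * j) * (qPochInv j * qPochInv (j + N)) :=
  X_pow_dvd_zq_mul (by omega) _ _

theorem X_pow_dvd_partialTheta_term (N j : ℕ) :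
    (PowerSeries.X : CharRing) ^ j ∣ (-1) ^ j * zq 0 (4 * j * (j + 1) + 4 * N * j) :=
  (X_pow_dvd_zq (by nlinarith) _).mul_left _

/-- Split off `j = 0` and shift: replacing `j` by `j + 1` adds `4N + 8 + 8j` to the exponent, and
the term `8j` raises `N` by `2`. -/
theorem partialTheta_eq (N : ℕ) :
    partialTheta N = 1 - zq 0 (4 * N + 8) * partialTheta (N + 2) := by
  have h := summable_nat (X_pow_dvd_partialTheta_term N)
  have h' := summable_nat (X_pow_dvd_partialTheta_term (N + 2))
  rw [partialTheta, h.tsum_eq_zero_add, partialTheta, ← h'.tsum_mul_left, sub_eq_add_neg,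
    ← tsum_neg]
  congr 1
  · simp [zq_zero_zero]
  · refine tsum_congr fun j => ?_
    rw [mul_left_comm, zq_mul_zq, pow_succ, mul_neg_one, neg_mul, zero_add]
    congr 3
    ring

/-- Telescoping through `1 - (1 - x)(1 - y) = x(1 - y) + y` with `x = P^j`, `y = P^(j+N+1)`. -/
theorem sum_range_diagonal (N M : ℕ) :
    ∑ j ∈ Finset.range (M + 1), (zq 0 (8 * j) * (qPochInv j * qPochInv (j + N)) +
      zq 0 (8 * (N + 1)) * (zq 0 (8 * j) * (qPochInv j * qPochInv (j + (N + 1))))) =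
    qPochInv M * qPochInv (M + (N + 1)) := by
  induction M with
  | zero =>
    rw [Finset.sum_range_one, mul_zero, zq_zero_zero, zero_add, zero_add, qPochInv_zero,
      ← one_sub_mul_qPochInv_succ N]
    ring
  | succ M ih =>
    rw [Finset.sum_range_succ, ih]
    have h1 := one_sub_mul_qPochInv_succ M
    have h2 := one_sub_mul_qPochInv_succ (M + 1 + N)
    have h3 : zq 0 (8 * (M + 1 + N + 1)) = zq 0 (8 * (N + 1)) * zq 0 (8 * (M + 1)) := by
      rw [zq_mul_zq, add_zero]
      congr 1
      ring
    rw [h3] at h2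
    rw [← h1, show M + (N + 1) = M + 1 + N by ring, ← h2,
      show M + 1 + (N + 1) = M + 1 + N + 1 by ring]
    ring

theorem diagonalSum_add (N : ℕ) :
    diagonalSum N + zq 0 (8 * (N + 1)) * diagonalSum (N + 1) = eulerSum 0 8 * eulerSum 0 8 := by
  have h1 := summable_nat (X_pow_dvd_diagonalSum_term N)
  have h2 := (summable_nat (X_pow_dvd_diagonalSum_term (N + 1))).mul_left (zq 0 (8 * (N + 1)))
  have h3 := (h1.add h2).hasSum.tendsto_sum_nat
  rw [h1.tsum_add h2, (summable_nat (X_pow_dvd_diagonalSum_term (N + 1))).tsum_mul_left] at h3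
  refine tendsto_nhds_unique ((Filter.tendsto_add_atTop_iff_nat 1).mpr h3) ?_
  simp_rw [sum_range_diagonal]
  exact tendsto_qPochInv.mul ((Filter.tendsto_add_atTop_iff_nat (N + 1)).mpr tendsto_qPochInv)

/-- The infinite product `∏_{l ≥ 1} (1 - q^(4l))`. -/
def qPochInf : CharRing := ∏' l : ℕ, (1 - zq 0 (8 * (l + 1)))

theorem qPochInf_mul_eulerSum : qPochInf * eulerSum 0 8 = 1 := by
  rw [← tprod_mul_eulerSum 0 (show 0 < 8 by omega), qPochInf]
  congr 1
  refine tprod_congr fun l => ?_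
  congr 2
  ring

theorem qPochInf_sq_mul_diagonalSum (N : ℕ) :
    qPochInf ^ 2 * diagonalSum N = partialTheta (2 * N) := by
  -- Both sides solve `f_N = 1 - P^(N+1) f_(N+1)`, so up to sign their difference at `N` is
  -- `P^(N+1)` times that at `N + 1`. Induction for all `N` at once makes it divisible by every
  -- power of `X`.
  refine eq_of_X_pow_dvd_sub fun k => ?_
  induction k generalizing N with
  | zero => simp
  | succ k ih =>
    have h : qPochInf ^ 2 * diagonalSum N =
        1 - zq 0 (8 * (N + 1)) * (qPochInf ^ 2 * diagonalSum (N + 1)) := by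
      rw [eq_sub_iff_add_eq]
      calc _ = qPochInf ^ 2 * (diagonalSum N + zq 0 (8 * (N + 1)) * diagonalSum (N + 1)) := by ring
        _ = (qPochInf * eulerSum 0 8) ^ 2 := by rw [diagonalSum_add]; ring
        _ = 1 := by rw [qPochInf_mul_eulerSum, one_pow]
    rw [h, partialTheta_eq, show 4 * (2 * N) + 8 = 8 * (N + 1) by ring, sub_sub_sub_cancel_left, ← mul_sub, pow_succ']
    refine mul_dvd_mul ?_ ?_
    · have := X_pow_dvd_zq (show 1 ≤ 8 * (N + 1) by omega) 0
      rwa [pow_one] at this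
    · rw [dvd_sub_comm]
      exact ih (N + 1)

/-! ## The product of two Euler series -/

/-- The arguments `x = z^2 q` and `y = z^(-2) q^3` satisfy `xy = P`, so along a diagonal `x^(N+j)
y^j = x^N P^j`, and symmetrically above the main diagonal. -/
theorem eulerSum_mul_eulerSum :
    eulerSum 2 2 * eulerSum (-2) 6 =
      (∑' N : ℕ, zq (2 * N) (2 * N) * diagonalSum N) +
        ∑' N : ℕ, zq (-2 * (N + 1 : ℕ)) (6 * (N + 1)) * diagonalSum (N + 1) := by
  have hf (p : ℕ × ℕ) : (PowerSeries.X : CharRing) ^ (p.1 + p.2) ∣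
      zq (2 * p.1) (2 * p.1) * qPochInv p.1 * (zq (-2 * p.2) (6 * p.2) * qPochInv p.2) := by
    rw [pow_add]
    exact mul_dvd_mul (X_pow_dvd_zq_mul (by omega) _ _) (X_pow_dvd_zq_mul (by omega) _ _)
  rw [eulerSum, eulerSum, (summable_nat (X_pow_dvd_euler_term 2 (show 0 < 2 by omega))).tsum_mul_tsum
    (summable_nat (X_pow_dvd_euler_term (-2) (show 0 < 6 by omega))) (summable_nat_prod hf),
    tsum_diagonal hf]
  congr 1
  · refine tsum_congr fun N => ?_
    rw [diagonalSum, ← (summable_nat (X_pow_dvd_diagonalSum_term N)).tsum_mul_left]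
    refine tsum_congr fun j => ?_
    have : zq (2 * (N + j : ℕ)) (2 * (N + j)) * zq (-2 * j) (6 * j) =
        zq (2 * N) (2 * N) * zq 0 (8 * j) := by
      rw [zq_mul_zq, zq_mul_zq]
      congr 1
      · push_cast; ring
      · ring
    rw [mul_mul_mul_comm, this, add_comm N j]
    ring
  · refine tsum_congr fun N => ?_
    rw [diagonalSum, ← (summable_nat (X_pow_dvd_diagonalSum_term (N + 1))).tsum_mul_left]
    refine tsum_congr fun j => ?_
    have : zq (2 * j) (2 * j) * zq (-2 * (N + 1 + j : ℕ)) (6 * (N + 1 + j)) =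
        zq (-2 * (N + 1 : ℕ)) (6 * (N + 1)) * zq 0 (8 * j) := by
      rw [zq_mul_zq, zq_mul_zq]
      congr 1
      · push_cast; ring
      · ring
    rw [mul_mul_mul_comm, this, show N + 1 + j = j + (N + 1) by ring]
    ring

/-! ## The double sum -/

theorem inverse_one_add_zq (m : ℤ) {n : ℕ} (hn : 0 < n) :
    Ring.inverse (1 + zq m n) = ∑' j : ℕ, (-1) ^ j * zq (m * j) (n * j) := by
  have h := PowerSeries.WithPiTopology.one_sub_mul_tsum_pow_of_constantCoeff_eq_zero
    (f := -zq m n) (by rw [map_neg, constantCoeff_zq m hn, neg_zero])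
  rw [sub_neg_eq_add] at h
  have h2 : ∑' j : ℕ, (-1) ^ j * zq (m * j) (n * j) = ∑' j : ℕ, (-zq m n) ^ j :=
    tsum_congr fun j => by rw [neg_pow (zq m n), zq_pow]
  refine (isUnit_one_add_zq m hn).mul_left_cancel ?_
  rw [Ring.mul_inverse_cancel _ (isUnit_one_add_zq m hn), h2, h]

theorem X_pow_dvd_double_term (s : CharRing) (m : ℤ) (p : ℕ × ℕ) :
    (PowerSeries.X : CharRing) ^ (p.1 + p.2) ∣ s * zq m (p.1 + 3 * p.2 + 4 * p.1 * p.2) :=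
  (X_pow_dvd_zq (by nlinarith [Nat.zero_le (p.1 * p.2)]) _).mul_left _

/-- Expand both geometric series and exchange the two indices in the second; the monomials then
agree and only the signs differ. -/
theorem doubleSum_eq_tsum_prod : doubleSum = ∑' p : ℕ × ℕ,
    ((-1 : CharRing) ^ p.2 + (-1) ^ p.1) * zq (p.1 - p.2) (p.1 + 3 * p.2 + 4 * p.1 * p.2) := by
  have h1 := fun p : ℕ × ℕ => X_pow_dvd_double_term ((-1) ^ p.2) (p.1 - p.2) p
  have h2 := fun p : ℕ × ℕ => X_pow_dvd_double_term ((-1) ^ p.1) (p.1 - p.2) p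
  have h3 (p : ℕ × ℕ) : (PowerSeries.X : CharRing) ^ (p.1 + p.2) ∣
      (-1) ^ p.2 * zq (p.2 - p.1) (p.2 + 3 * p.1 + 4 * p.2 * p.1) := by
    rw [add_comm]
    exact X_pow_dvd_double_term ((-1) ^ p.2) (p.2 - p.1) p.swap
  simp_rw [add_mul]
  rw [(summable_nat_prod h1).tsum_add (summable_nat_prod h2), doubleSum]
  congr 1
  · rw [tsum_nat_prod h1]
    refine tsum_congr fun k => ?_
    rw [inverse_one_add_zq _ (by omega), ← Summable.tsum_mul_left]
    · refine tsum_congr fun j => ?_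
      rw [mul_left_comm, zq_mul_zq]
      congr 2 <;> ring
    · exact summable_nat fun j => (X_pow_dvd_zq (by nlinarith) _).mul_left _
  · refine Eq.trans ?_ ((Equiv.prodComm ℕ ℕ).tsum_eq _)
    simp only [Equiv.prodComm_apply, Prod.fst_swap, Prod.snd_swap]
    rw [tsum_nat_prod h3]
    refine tsum_congr fun k => ?_
    rw [inverse_one_add_zq _ (by omega), ← Summable.tsum_mul_left]
    · refine tsum_congr fun j => ?_
      rw [mul_left_comm, zq_mul_zq]
      congr 2 <;> ring
    · exact summable_nat fun j => (X_pow_dvd_zq (by nlinarith) _).mul_left _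

theorem tsum_eq_tsum_even {f : ℕ → CharRing} (hf : ∀ k, PowerSeries.X ^ k ∣ f k)
    (h0 : ∀ k, f (2 * k + 1) = 0) : ∑' k, f k = ∑' k, f (2 * k) := by
  rw [← tsum_even_add_odd (summable_nat fun k => (pow_dvd_pow _ (by omega)).trans (hf (2 * k)))
    (summable_nat fun k => (pow_dvd_pow _ (by omega)).trans (hf (2 * k + 1)))]
  simp only [h0, tsum_zero, add_zero]

theorem tsum_eq_tsum_odd {f : ℕ → CharRing} (hf : ∀ k, PowerSeries.X ^ k ∣ f k)
    (h0 : ∀ k, f (2 * k) = 0) : ∑' k, f k = ∑' k, f (2 * k + 1) := by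
  rw [← tsum_even_add_odd (summable_nat fun k => (pow_dvd_pow _ (by omega)).trans (hf (2 * k)))
    (summable_nat fun k => (pow_dvd_pow _ (by omega)).trans (hf (2 * k + 1)))]
  simp only [h0, tsum_zero, zero_add]

theorem tsum_lower_diagonal (N : ℕ) :
    ∑' j : ℕ, ((-1 : CharRing) ^ j + (-1) ^ (N + j)) *
      zq ((N + j : ℕ) - (j : ℕ)) (N + j + 3 * j + 4 * (N + j) * j) =
    (1 + (-1) ^ N) * (zq N N * partialTheta N) := by
  rw [partialTheta, ← (summable_nat (X_pow_dvd_partialTheta_term N)).tsum_mul_left,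
    ← Summable.tsum_mul_left]
  · refine tsum_congr fun j => ?_
    rw [mul_left_comm (zq _ _), zq_mul_zq, pow_add,
      show ((N + j : ℕ) : ℤ) - (j : ℕ) = N + 0 by push_cast; ring,
      show N + j + 3 * j + 4 * (N + j) * j = N + (4 * j * (j + 1) + 4 * N * j) by ring]
    ring
  · exact summable_nat fun j => (X_pow_dvd_partialTheta_term N j).mul_left _

theorem tsum_upper_diagonal (N : ℕ) :
    ∑' j : ℕ, ((-1 : CharRing) ^ (N + j) + (-1) ^ j) *
      zq ((j : ℕ) - (N + j : ℕ)) (j + 3 * (N + j) + 4 * j * (N + j)) =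
    (1 + (-1) ^ N) * (zq (-N) (3 * N) * partialTheta N) := by
  rw [partialTheta, ← (summable_nat (X_pow_dvd_partialTheta_term N)).tsum_mul_left,
    ← Summable.tsum_mul_left]
  · refine tsum_congr fun j => ?_
    rw [mul_left_comm (zq _ _), zq_mul_zq, pow_add,
      show (j : ℤ) - (N + j : ℕ) = -N + 0 by push_cast; ring,
      show j + 3 * (N + j) + 4 * j * (N + j) = 3 * N + (4 * j * (j + 1) + 4 * N * j) by ring]
    ring
  · exact summable_nat fun j => (X_pow_dvd_partialTheta_term N j).mul_left _

/-- The factor `1 + (-1)^N` on the diagonal at distance `N` kills odd `N` and doubles even `N`. -/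
theorem doubleSum_eq_partialTheta : doubleSum =
    2 * ((∑' N : ℕ, zq (2 * N) (2 * N) * partialTheta (2 * N)) +
      ∑' N : ℕ, zq (-2 * (N + 1 : ℕ)) (6 * (N + 1)) * partialTheta (2 * (N + 1))) := by
  have hodd (N : ℕ) : (1 : CharRing) + (-1) ^ (2 * N + 1) = 0 := by
    rw [pow_succ, pow_mul, neg_one_sq, one_pow]; ring
  have heven (N : ℕ) : (1 : CharRing) + (-1) ^ (2 * N) = 2 := by
    rw [pow_mul, neg_one_sq, one_pow]; norm_num
  rw [doubleSum_eq_tsum_prod, tsum_diagonal fun p : ℕ × ℕ =>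
    X_pow_dvd_double_term ((-1) ^ p.2 + (-1) ^ p.1) (p.1 - p.2) p]
  dsimp only
  simp_rw [tsum_lower_diagonal, tsum_upper_diagonal]
  rw [tsum_eq_tsum_even (f := fun N => (1 + (-1) ^ N) * (zq N N * partialTheta N))
      (fun N => (X_pow_dvd_zq_mul le_rfl _ _).mul_left _) fun N => by rw [hodd, zero_mul],
    tsum_eq_tsum_odd (f := fun N => (1 + (-1) ^ (N + 1)) *
        (zq (-(N + 1 : ℕ)) (3 * (N + 1)) * partialTheta (N + 1)))
      (fun N => (X_pow_dvd_zq_mul (by omega) _ _).mul_left _) fun N => by rw [hodd, zero_mul],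
    mul_add, ← Summable.tsum_mul_left, ← Summable.tsum_mul_left]
  · refine congrArg₂ (· + ·) (tsum_congr fun N => ?_) (tsum_congr fun N => ?_)
    · rw [heven, Nat.cast_mul, Nat.cast_ofNat]
    · rw [show 2 * N + 1 + 1 = 2 * (N + 1) by ring, heven,
        show -((2 * (N + 1) : ℕ) : ℤ) = -2 * (N + 1 : ℕ) by push_cast; ring,
        show 3 * (2 * (N + 1)) = 6 * (N + 1) by ring]
  · exact summable_nat fun N => X_pow_dvd_zq_mul (by omega) _ _
  · exact summable_nat fun N => X_pow_dvd_zq_mul (by omega) _ _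

theorem doubleSum_eq_eulerSum :
    doubleSum = 2 * (qPochInf ^ 2 * (eulerSum 2 2 * eulerSum (-2) 6)) := by
  rw [doubleSum_eq_partialTheta, eulerSum_mul_eulerSum, mul_add (qPochInf ^ 2),
    ← Summable.tsum_mul_left, ← Summable.tsum_mul_left]
  · simp only [← qPochInf_sq_mul_diagonalSum, mul_left_comm]
  · exact summable_nat fun N => X_pow_dvd_zq_mul (by omega) _ _
  · exact summable_nat fun N => X_pow_dvd_zq_mul (by omega) _ _

/-! ## Comparison of the products -/

theorem isUnit_two : IsUnit (2 : CharRing) := by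
  have := (IsUnit.mk0 (2 : ℚ) two_ne_zero).map (algebraMap ℚ CharRing)
  rwa [map_ofNat] at this

theorem eq_mul_inverse_iff {x y u : CharRing} (hu : IsUnit u) :
    x = y * Ring.inverse u ↔ u * x = y := by
  constructor
  · rintro rfl
    rw [mul_left_comm, Ring.mul_inverse_cancel _ hu, mul_one]
  · rintro rfl
    rw [mul_right_comm, Ring.mul_inverse_cancel _ hu, one_mul]

theorem eq_inverse_of_mul_eq_one {x u : CharRing} (h : u * x = 1) : x = Ring.inverse u := by
  have := (eq_mul_inverse_iff (IsUnit.of_mul_eq_one x h)).mpr h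
  rwa [one_mul] at this

theorem isUnit_tprod_one_add (m : ℕ → ℤ) (a : ℕ → ℕ) (ha : ∀ l, l < a l) :
    IsUnit (∏' l, (1 + zq (m l) (a l))) :=
  isUnit_tprod (multipliable_one_add m a fun l => (ha l).le) fun l => by
    simp [constantCoeff_zq (m l) (Nat.zero_lt_of_lt (ha l))]

theorem isUnit_tprod_one_sub (m : ℕ → ℤ) (a : ℕ → ℕ) (ha : ∀ l, l < a l) :
    IsUnit (∏' l, (1 - zq (m l) (a l))) :=
  isUnit_tprod (multipliable_one_sub m a fun l => (ha l).le) fun l => by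
    simp [constantCoeff_zq (m l) (Nat.zero_lt_of_lt (ha l))]

/-- `∏ (1 + x_l) ∏ (1 - x_l) = ∏ (1 - x_l^2)`. -/
theorem tprod_one_add_mul_tprod_one_sub (m : ℕ → ℤ) (a : ℕ → ℕ) (ha : ∀ l, l < a l) :
    (∏' l, (1 + zq (m l) (a l))) * (∏' l, (1 - zq (m l) (a l))) =
      ∏' l, (1 - zq (2 * m l) (2 * a l)) := by
  rw [← (multipliable_one_add m a fun l => (ha l).le).tprod_mul
    (multipliable_one_sub m a fun l => (ha l).le)]
  refine tprod_congr fun l => ?_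
  rw [two_mul (m l), two_mul (a l), ← zq_mul_zq]
  ring

theorem tprod_chi_eq : (∏' i : ℕ, (1 - zq ((-1) ^ i) (2 * i + 1))) =
    (∏' l : ℕ, (1 - zq 1 (4 * l + 1))) * ∏' l : ℕ, (1 - zq (-1) (4 * l + 3)) := by
  have h1 (l : ℕ) : 1 - zq ((-1) ^ (2 * l)) (2 * (2 * l) + 1) = 1 - zq 1 (4 * l + 1) := by
    rw [pow_mul, neg_one_sq, one_pow, show 2 * (2 * l) + 1 = 4 * l + 1 by ring]
  have h2 (l : ℕ) :
      1 - zq ((-1) ^ (2 * l + 1)) (2 * (2 * l + 1) + 1) = 1 - zq (-1) (4 * l + 3) := by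
    rw [pow_succ, pow_mul, neg_one_sq, one_pow, one_mul,
      show 2 * (2 * l + 1) + 1 = 4 * l + 3 by ring]
  rw [← tprod_even_mul_odd]
  · simp only [h1, h2]
  · simp only [h1]
    exact multipliable_one_sub (fun _ => 1) (fun l => 4 * l + 1) fun l => by omega
  · simp only [h2]
    exact multipliable_one_sub (fun _ => -1) (fun l => 4 * l + 3) fun l => by omega

/-- Euler's identity at `z^2 q` and `z^(-2) q^3` makes the two products inverse to the two Euler
series. -/
theorem tprod_mul_doubleSum :
    (∏' l : ℕ, (1 - zq 2 (8 * l + 2))) * (∏' l : ℕ, (1 - zq (-2) (8 * l + 6))) * doubleSum =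
      2 * qPochInf ^ 2 := by
  have h1 := tprod_mul_eulerSum 2 (show 0 < 2 by omega)
  have h2 := tprod_mul_eulerSum (-2) (show 0 < 6 by omega)
  simp only [add_comm 2 (8 * _), add_comm 6 (8 * _)] at h1 h2
  rw [doubleSum_eq_eulerSum]
  linear_combination (2 * qPochInf ^ 2) * h1 + (2 * qPochInf ^ 2 *
    ((∏' l : ℕ, (1 - zq 2 (8 * l + 2))) * eulerSum 2 2)) * h2

theorem qPochInf_sq : ∏' l : ℕ, (1 - zq 0 (8 * (l + 1))) ^ 2 = qPochInf ^ 2 := by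
  rw [Multipliable.tprod_pow]
  · rfl
  · exact multipliable_one_sub (fun _ => 0) (fun l => 8 * (l + 1)) fun l => by omega

theorem isUnit_qPochInf : IsUnit qPochInf := IsUnit.of_mul_eq_one _ qPochInf_mul_eulerSum

end CKP

end

/-! ### Elimination between the product formulas -/

theorem mainTheorem1 :
    -- the two characters are well defined
    CKP.HasCharacter CKP.Fhwv ∧ CKP.HasCharacter ⊤ ∧
    -- the character of the space of highest weight vectors
    CKP.character CKP.Fhwv =
      (∏' l : ℕ, (1 + CKP.zq 1 (4 * l + 1))) * (∏' l : ℕ, (1 + CKP.zq (-1) (4 * l + 3))) *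
        Ring.inverse
          (2 * ∏' i : ℕ, (1 - CKP.zq 0 (8 * (i + 1))) * (1 + CKP.zq 0 (4 * (i + 1)))) *
        CKP.doubleSum ∧
    -- the character of the Fock space
    CKP.character ⊤ =
      (∏' l : ℕ, (1 + CKP.zq 1 (4 * l + 1))) * (∏' l : ℕ, (1 + CKP.zq (-1) (4 * l + 3))) *
        Ring.inverse (2 * ∏' l : ℕ, (1 - CKP.zq 0 (8 * (l + 1))) ^ 2) *
        CKP.doubleSum ∧
    -- the product form of the character of the Fock space
    CKP.character ⊤ =
      Ring.inverse
        (∏' j : ℕ, (1 - CKP.zq 1 (4 * j + 1)) * (1 - CKP.zq (-1) (4 * j + 3))) ∧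
    -- the sum-versus-product identity
    CKP.doubleSum =
      2 * (∏' l : ℕ, (1 - CKP.zq 0 (8 * (l + 1))) ^ 2) *
        Ring.inverse
          ((∏' l : ℕ, (1 - CKP.zq 2 (8 * l + 2))) *
            ∏' l : ℕ, (1 - CKP.zq (-2) (8 * l + 6))) := by
  open CKP in
  have hV1 : (∏' l : ℕ, (1 + zq 1 (4 * l + 1))) * (∏' l : ℕ, (1 - zq 1 (4 * l + 1))) =
      ∏' l : ℕ, (1 - zq 2 (8 * l + 2)) := by
    rw [tprod_one_add_mul_tprod_one_sub (fun _ => 1) (fun l => 4 * l + 1) fun l => by omega]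
    refine tprod_congr fun l => ?_
    rw [mul_one, show 2 * (4 * l + 1) = 8 * l + 2 by ring]
  have hV2 : (∏' l : ℕ, (1 + zq (-1) (4 * l + 3))) * (∏' l : ℕ, (1 - zq (-1) (4 * l + 3))) =
      ∏' l : ℕ, (1 - zq (-2) (8 * l + 6)) := by
    rw [tprod_one_add_mul_tprod_one_sub (fun _ => -1) (fun l => 4 * l + 3) fun l => by omega]
    refine tprod_congr fun l => ?_
    rw [mul_neg_one, show 2 * (4 * l + 3) = 8 * l + 6 by ring]
  have hE : (∏' i : ℕ, (1 + zq 0 (4 * (i + 1)))) * (∏' i : ℕ, (1 - zq 0 (4 * (i + 1)))) =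
      qPochInf := by
    rw [tprod_one_add_mul_tprod_one_sub (fun _ => 0) (fun l => 4 * (l + 1)) fun l => by omega]
    refine tprod_congr fun l => ?_
    rw [mul_zero, show 2 * (4 * (l + 1)) = 8 * (l + 1) by ring]
  have hQE : (∏' i : ℕ, (1 - zq 0 (8 * (i + 1))) * (1 + zq 0 (4 * (i + 1)))) =
      qPochInf * ∏' i : ℕ, (1 + zq 0 (4 * (i + 1))) :=
    (multipliable_one_sub (fun _ => 0) (fun l => 8 * (l + 1)) fun l => by omega).tprod_mul
      (multipliable_one_add (fun _ => 0) (fun l => 4 * (l + 1)) fun l => by omega)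
  have hW : (∏' j : ℕ, (1 - zq 1 (4 * j + 1)) * (1 - zq (-1) (4 * j + 3))) =
      (∏' l : ℕ, (1 - zq 1 (4 * l + 1))) * ∏' l : ℕ, (1 - zq (-1) (4 * l + 3)) :=
    (multipliable_one_sub (fun _ => 1) (fun l => 4 * l + 1) fun l => by omega).tprod_mul
      (multipliable_one_sub (fun _ => -1) (fun l => 4 * l + 3) fun l => by omega)
  have hW1 := isUnit_tprod_one_sub (fun _ => 1) (fun l => 4 * l + 1) fun l => by omega
  have hW2 := isUnit_tprod_one_sub (fun _ => -1) (fun l => 4 * l + 3) fun l => by omega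
  have hU1 := isUnit_tprod_one_add (fun _ => 1) (fun l => 4 * l + 1) fun l => by omega
  have hU2 := isUnit_tprod_one_add (fun _ => -1) (fun l => 4 * l + 3) fun l => by omega
  have hUE := isUnit_tprod_one_add (fun _ => 0) (fun l => 4 * (l + 1)) fun l => by omega
  have hC := tprod_mul_character_top
  have hS := tprod_mul_doubleSum
  have hF := character_Fhwv
  rw [tprod_chi_eq] at hC
  rw [hW, hQE, qPochInf_sq, ← hV1, ← hV2]
  rw [← hV1, ← hV2] at hS
  refine ⟨Fhwv_eq ▸ hasCharacter_iInf_ker_heis,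
    hasCharacter_of_invariant (fun _ _ => trivial) fun _ _ => trivial, ?_⟩
  generalize (∏' l : ℕ, (1 - zq 1 (4 * l + 1))) = W1 at *
  generalize (∏' l : ℕ, (1 - zq (-1) (4 * l + 3))) = W2 at *
  generalize (∏' l : ℕ, (1 + zq 1 (4 * l + 1))) = U1 at *
  generalize (∏' l : ℕ, (1 + zq (-1) (4 * l + 3))) = U2 at *
  generalize (∏' i : ℕ, (1 + zq 0 (4 * (i + 1)))) = E1 at *
  generalize (∏' i : ℕ, (1 - zq 0 (4 * (i + 1)))) = E2 at *
  have hQ := isUnit_qPochInf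
  -- Here `W1 W2` is inverse to the Fock character, while `U1 W1 U2 W2 S = 2 qPochInf^2`;
  -- eliminating `W1 W2` gives all formulas containing `S`.
  have hSC : 2 * qPochInf ^ 2 * character ⊤ = U1 * U2 * doubleSum := by
    linear_combination (U1 * U2 * doubleSum) * hC - character ⊤ * hS
  refine ⟨?_, ?_, eq_inverse_of_mul_eq_one hC, ?_⟩
  -- The factor `∏ (1 - q^(2i))` from the Heisenberg modes combines with `∏ (1 + q^(2i))` into a
  -- second copy of `qPochInf`.
  · rw [mul_right_comm, eq_mul_inverse_iff (isUnit_two.mul (hQ.mul hUE)), hF, ← hSC]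
    linear_combination (2 * qPochInf * character ⊤) * hE
  · rw [mul_right_comm, eq_mul_inverse_iff (isUnit_two.mul (hQ.pow 2)), hSC]
  · rw [eq_mul_inverse_iff ((hU1.mul hW1).mul (hU2.mul hW2)), hS]
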